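/- For $\nu\in\mathbb{R}$ and $z>0$ let $K_\nu(z)=\int_0^\infty e^{-z\cosh t}\cosh(\nu t)\,dt$ be the modified Bessel function of the third kind. For $p\ge 1$, $x,\mu\in\mathbb{R}^p$ and a real symmetric positive definite $p\times p$ matrix $\Sigma$ write $\delta(x,\mu\mid\Sigma)=(x-\mu)'\Sigma^{-1}(x-\mu)$. The $p$-dimensional generalized hyperbolic distribution has the density $$f(x\mid\theta)=\left[\frac{\omega+\delta(x,\mu\mid\Sigma)}{\omega+\beta'\Sigma^{-1}\beta}\right]^{(\lambda-p/2)/2}\frac{K_{\lambda-p/2}\left(\sqrt{[\omega+\beta'\Sigma^{-1}\beta]\,[\omega+\delta(x,\mu\mid\Sigma)]}\right)}{(2\pi)^{p/2}|\Sigma|^{1/2}K_\lambda(\omega)\exp\{-(x-\mu)'\Sigma^{-1}\beta\}},\qquad x\in\mathbb{R}^p,$$ with parameter $\theta=(\lambda,\omega,\mu,\Sigma,\beta)$, where $\lambda\in\mathbb{R}$, $\omega>0$, $\mu,\beta\in\mathbb{R}^p$ and $\Sigma$ is symmetric positive definite; in the unit-determinant parameterization $\vartheta=(\lambda,\chi,\psi,\mu,\Delta,\alpha)$,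 where $\lambda\in\mathbb{R}$, $\chi,\psi>0$, $\mu,\alpha\in\mathbb{R}^p$ and $\Delta$ is symmetric positive definite with $|\Delta|=1$, its density is $$f(x\mid\vartheta)=\left[\frac{\chi+\delta(x,\mu\mid\Delta)}{\psi+\alpha'\Delta^{-1}\alpha}\right]^{(\lambda-p/2)/2}\frac{(\psi/\chi)^{\lambda/2}K_{\lambda-p/2}\left(\sqrt{[\psi+\alpha'\Delta^{-1}\alpha]\,[\chi+\delta(x,\mu\mid\Delta)]}\right)}{(2\pi)^{p/2}|\Delta|^{1/2}K_\lambda(\sqrt{\chi\psi})\exp\{(\mu-x)'\Delta^{-1}\alpha\}},\qquad x\in\mathbb{R}^p.$$ Corollary. For every $p\ge1$, finite mixtures of $p$-dimensional generalized hyperbolic distributions are identifiable, in each of the two parameterizations: if $\theta_1,\dots,\theta_G$ are pairwise distinct parameters, $\theta'_1,\dots,\theta'_H$ are pairwise distinct parameters, $\pi_g>0$, $\pi'_h>0$, $\sum_{g=1}^G\pi_g=\sum_{h=1}^H\pi'_h=1$, and $$\sum_{g=1}^G\pi_g f(x\mid\theta_g)=\sum_{h=1}^H\pi'_h f(x\mid\theta'_h)\qquad\text{for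 all }x\in\mathbb{R}^p,$$ then $G=H$ and there is a permutation $\sigma$ of $\{1,\dots,G\}$ such that $(\pi_g,\theta_g)=(\pi'_{\sigma(g)},\theta'_{\sigma(g)})$ for all $g$. -/

import Mathlib

open scoped Matrix

noncomputable section

/-- The modified Bessel function of the third kind `K_ν(z)` with real index `ν`, for `z > 0`,
through its classical integral representation
`K_ν(z) = ∫_0^∞ exp(-z cosh t) cosh(ν t) dt`. -/
def besselK (ν z : ℝ) : ℝ :=
  ∫ t in Set.Ioi (0 : ℝ), Real.exp (-z * Real.cosh t) * Real.cosh (ν * t)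

/-- The squared Mahalanobis distance `(x - μ)' S⁻¹ (x - μ)`. -/
def sqMahalanobis {p : ℕ} (x μ : Fin p → ℝ) (S : Matrix (Fin p) (Fin p) ℝ) : ℝ :=
  (x - μ) ⬝ᵥ (S⁻¹ *ᵥ (x - μ))

/-- Parameters `(lam, ω, μ, Σ, β)`: index, concentration, location, scale matrix, skewness. -/
@[ext]
structure GHParam (p : ℕ) where
  lam : ℝ
  ω : ℝ
  μ : Fin p → ℝ
  S : Matrix (Fin p) (Fin p) ℝ
  β : Fin p → ℝ

/-- The admissible parameters: `ω > 0` and `Σ` symmetric positive definite;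
`lam`, `μ` and `β` are arbitrary. -/
def GHParam.admissible (p : ℕ) : Set (GHParam p) :=
  {θ | 0 < θ.ω ∧ θ.S.PosDef}

/-- The `p`-dimensional generalized hyperbolic density with parameters `(lam, ω, μ, Σ, β)`. -/
def GHParam.density {p : ℕ} (θ : GHParam p) (x : Fin p → ℝ) : ℝ :=
  ((θ.ω + sqMahalanobis x θ.μ θ.S) / (θ.ω + θ.β ⬝ᵥ (θ.S⁻¹ *ᵥ θ.β)))
      ^ ((θ.lam - (p : ℝ) / 2) / 2)
    * (besselK (θ.lam - (p : ℝ) / 2)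
          (√((θ.ω + θ.β ⬝ᵥ (θ.S⁻¹ *ᵥ θ.β)) * (θ.ω + sqMahalanobis x θ.μ θ.S)))
        / ((2 * Real.pi) ^ ((p : ℝ) / 2) * √(θ.S.det) * besselK θ.lam θ.ω
            * Real.exp (-((x - θ.μ) ⬝ᵥ (θ.S⁻¹ *ᵥ θ.β)))))

/-- Parameters `(lam, χ, ψ, μ, Δ, α)` of the unit-determinant parameterization. -/
@[ext]
structure GHUnitParam (p : ℕ) where
  lam : ℝ
  χ : ℝ
  ψ : ℝ
  μ : Fin p → ℝ
  D : Matrix (Fin p) (Fin p) ℝ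
  α : Fin p → ℝ

/-- The admissible parameters: `χ, ψ > 0` and `Δ` symmetric positive definite with `|Δ| = 1`;
`lam`, `μ` and `α` are arbitrary. -/
def GHUnitParam.admissible (p : ℕ) : Set (GHUnitParam p) :=
  {θ | 0 < θ.χ ∧ 0 < θ.ψ ∧ θ.D.PosDef ∧ θ.D.det = 1}

/-- The `p`-dimensional generalized hyperbolic density with parameters
`(lam, χ, ψ, μ, Δ, α)`. -/
def GHUnitParam.density {p : ℕ} (θ : GHUnitParam p) (x : Fin p → ℝ) : ℝ :=
  ((θ.χ + sqMahalanobis x θ.μ θ.D) / (θ.ψ + θ.α ⬝ᵥ (θ.D⁻¹ *ᵥ θ.α)))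
      ^ ((θ.lam - (p : ℝ) / 2) / 2)
    * ((θ.ψ / θ.χ) ^ (θ.lam / 2)
        * besselK (θ.lam - (p : ℝ) / 2)
          (√((θ.ψ + θ.α ⬝ᵥ (θ.D⁻¹ *ᵥ θ.α)) * (θ.χ + sqMahalanobis x θ.μ θ.D)))
        / ((2 * Real.pi) ^ ((p : ℝ) / 2) * √(θ.D.det) * besselK θ.lam (√(θ.χ * θ.ψ))
            * Real.exp ((θ.μ - x) ⬝ᵥ (θ.D⁻¹ *ᵥ θ.α))))

/-- Finite mixtures of the densities `f θ`, `θ ∈ A`, are identifiable: if two finite mixtures,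
each with positive weights that sum to one and with pairwise distinct parameters in `A`, have the
same density function, then they have the same number of components, and up to a relabelling of
the components the same weights and the same parameters. -/
def FiniteMixturesIdentifiable {Θ X : Type*} (A : Set Θ) (f : Θ → X → ℝ) : Prop :=
  ∀ (G H : ℕ) (w : Fin G → ℝ) (v : Fin H → ℝ) (θ : Fin G → Θ) (η : Fin H → Θ),
    (∀ g, 0 < w g) → (∀ h, 0 < v h) → ∑ g, w g = 1 → ∑ h, v h = 1 →
    (∀ g, θ g ∈ A) → (∀ h, η h ∈ A) → Function.Injective θ → Function.Injective η →
    (∀ x, ∑ g, w g * f (θ g) x = ∑ h, v h * f (η h) x) →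
    ∃ σ : Fin G ≃ Fin H, ∀ g, w g = v (σ g) ∧ θ g = η (σ g)

end

/-!
Finite mixtures are identifiable as soon as the densities of pairwise distinct parameters are
linearly independent (`finiteMixturesIdentifiable_of_linearIndependent`). Write
`W_ν(w) = w ^ (ν / 2) * K_ν(√w)` (`besselW`). In both parameterizations the density is a nonzero
multiple of the canonical function `exp (g · x) * W_ν((x - μ)' M (x - μ) + C)` (`ghCore`), where
`ν = lam - p / 2`, `M = a • Σ⁻¹` with `a = ω + β' Σ⁻¹ β`, `g = Σ⁻¹ β` and `C = a * ω`, respectively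
their analogues for `Δ`, and `(ν, C, μ, g, M)` determines the original parameter
(`GHParam.injOn_canonical`, `GHUnitParam.injOn_canonical`). On a line `x = t d` through the origin
the canonical function becomes `exp (γ t) * W_ν(α² (t - m)² + B)`, and for a generic direction `d`
finitely many distinct parameters stay distinct (`eq_zero_of_sum_ghCore_eq_zero`). It remains to
prove linear independence on the line (`eq_zero_of_sum_exp_mul_besselW_eq_zero`), in two steps.

*Separation of `(α, γ)`.* Schläfli's formula (`besselL_eq_besselW`) shows that, away from the
origin, `exp z * K_ν(z)` is holomorphic and of polynomial growth on sectors of opening larger than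
`π`. Hence a term is
`exp (-(α - γ) t)` times a function with a holomorphic extension of polynomial growth to the sector
`|arg t| < 3π / 4` (`hasConeExtension_besselW`). In a vanishing linear combination, the sum of the
terms of smallest rate `α - γ`, freed of this common exponential, again has such an extension, and
it decays exponentially along the positive axis because it equals minus the remaining terms. By the
Phragmén–Lindelöf principle it vanishes (`HasConeExtension.eventually_eq_zero`). So the relation
splits exactly according to `α - γ`, and, by the reflection `t ↦ -t`, also according to `α + γ`
(`sum_filter_besselW_eq_zero`).

*Separation of `(ν, m, B)` for a common `(α, γ)`.* After division by `exp (γ t)` the Fourier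
transform of a term is, with `q = 1 + ξ² / α²` and `κ = ν + 1 / 2`, a constant times
`exp (i ξ m) * q ^ (-κ) * W_κ(B q)` (`integral_fourier_besselW`). The asymptotics of the Bessel
function identify first the smallest `B` and then the smallest `ν` among the terms present, and what
is left is a trigonometric sum in `ξ` that tends to zero, so that its coefficients vanish
(`eq_zero_of_tendsto_trigonometric_sum`, `eq_zero_of_sum_besselW_eq_zero`).
-/

noncomputable section

open MeasureTheory Set Filter Topology

/-! ### Integral representations of the Bessel function -/

lemma cosh_eq_one_add_two_mul_sinh_sq (s : ℝ) :
    Real.cosh s = 1 + 2 * Real.sinh (s / 2) ^ 2 := by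
  have h := Real.cosh_two_mul (s / 2)
  rw [show 2 * (s / 2) = s by ring] at h
  rw [h, Real.cosh_sq]; ring

lemma sq_div_two_le_cosh (s : ℝ) : s ^ 2 / 2 ≤ Real.cosh s := by
  have h2 : (s / 2) ^ 2 ≤ Real.sinh (s / 2) ^ 2 := by
    rw [sq_le_sq, Real.abs_sinh]
    exact Real.self_le_sinh_iff.2 (abs_nonneg _)
  rw [cosh_eq_one_add_two_mul_sinh_sq]; nlinarith

lemma integrable_exp_neg_cosh (ν : ℝ) {z : ℝ} (hz : 0 < z) :
    Integrable fun s : ℝ => Real.exp (-z * Real.cosh s + ν * s) := by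
  have h' : Integrable fun s : ℝ => Real.exp (-(z / 2) * s ^ 2 + ν * s) := by
    have := (integrable_cexp_quadratic' (b := ((-(z / 2) : ℝ) : ℂ))
      (by rw [Complex.ofReal_re]; linarith) (ν : ℂ) 0).norm
    refine this.congr (ae_of_all _ fun s => ?_)
    simp only [Complex.norm_exp]
    congr 1
    rw [show ((-(z / 2) : ℝ) : ℂ) * (s : ℂ) ^ 2 + (ν : ℂ) * s + 0
      = ((-(z / 2) * s ^ 2 + ν * s : ℝ) : ℂ) by push_cast; ring, Complex.ofReal_re]
  refine h'.mono' (by fun_prop) (ae_of_all _ fun s => ?_)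
  rw [Real.norm_eq_abs, Real.abs_exp, Real.exp_le_exp]
  nlinarith [sq_div_two_le_cosh s]

lemma besselK_eq_integral (ν : ℝ) {z : ℝ} (hz : 0 < z) :
    besselK ν z = (1 / 2) * ∫ s : ℝ, Real.exp (-z * Real.cosh s + ν * s) := by
  have hi := integrable_exp_neg_cosh ν hz
  have hi' := integrable_exp_neg_cosh (-ν) hz
  rw [← intervalIntegral.integral_Iic_add_Ioi (b := 0) hi.integrableOn hi.integrableOn]
  have h1 : ∫ s in Iic (0 : ℝ), Real.exp (-z * Real.cosh s + ν * s)
      = ∫ s in Ioi (0 : ℝ), Real.exp (-z * Real.cosh s + -ν * s) := by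
    have := integral_comp_neg_Ioi (0 : ℝ) fun s => Real.exp (-z * Real.cosh s + ν * s)
    rw [neg_zero] at this
    rw [← this]
    simp [Real.cosh_neg]
  rw [h1, ← integral_add hi'.integrableOn hi.integrableOn, besselK, ← integral_const_mul]
  refine integral_congr_ae (ae_of_all _ fun s => ?_)
  simp only [Real.exp_add, Real.cosh_eq (ν * s)]
  ring_nf

lemma besselK_pos (ν : ℝ) {z : ℝ} (hz : 0 < z) : 0 < besselK ν z := by
  rw [besselK_eq_integral ν hz]
  have := integral_exp_pos (integrable_exp_neg_cosh ν hz)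
  positivity

lemma besselK_neg (ν z : ℝ) : besselK (-ν) z = besselK ν z := by
  simp [besselK, Real.cosh_neg, neg_mul]

/-- The function `w ↦ w ^ (ν / 2) * K_ν(√w)`, for `w > 0`. Up to a scaling of its argument it is
the profile of the generalized hyperbolic density as a function of the Mahalanobis distance. -/
def besselW (ν w : ℝ) : ℝ := w ^ (ν / 2) * besselK ν (√w)

/-- The integrand of the representation of `besselW ν w` as a (logarithmically parametrized)
mixture of exponentials in `w`. -/
def besselWKernel (ν w t : ℝ) : ℝ := Real.exp (ν * t - Real.exp t / 2 - w / 2 * Real.exp (-t))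

lemma besselWKernel_add_log (ν : ℝ) {z : ℝ} (hz : 0 < z) (s : ℝ) :
    besselWKernel ν (z ^ 2) (s + Real.log z)
      = z ^ ν * Real.exp (-z * Real.cosh s + ν * s) := by
  rw [besselWKernel, Real.rpow_def_of_pos hz, ← Real.exp_add, Real.exp_add s, neg_add,
    Real.exp_add (-s), Real.exp_neg (Real.log z), Real.exp_log hz, Real.cosh_eq]
  congr 1
  field_simp
  ring

lemma integrable_besselWKernel (ν : ℝ) {w : ℝ} (hw : 0 < w) :
    Integrable (besselWKernel ν w) := by
  have h := ((integrable_exp_neg_cosh ν (Real.sqrt_pos.2 hw)).const_mul (√w ^ ν)).comp_sub_right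
    (Real.log √w)
  refine h.congr (ae_of_all _ fun t => ?_)
  have := besselWKernel_add_log ν (Real.sqrt_pos.2 hw) (t - Real.log √w)
  rw [sub_add_cancel, Real.sq_sqrt hw.le] at this
  exact this.symm

lemma besselW_eq_integral (ν : ℝ) {w : ℝ} (hw : 0 < w) :
    besselW ν w = (1 / 2) * ∫ t, besselWKernel ν w t := by
  have hz := Real.sqrt_pos.2 hw
  rw [← integral_add_right_eq_self (besselWKernel ν w) (Real.log √w), besselW,
    besselK_eq_integral ν hz]
  have h : ∀ s, besselWKernel ν w (s + Real.log √w)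
      = √w ^ ν * Real.exp (-√w * Real.cosh s + ν * s) := fun s => by
    have := besselWKernel_add_log ν hz s
    rwa [Real.sq_sqrt hw.le] at this
  simp_rw [h]
  rw [integral_const_mul, Real.sqrt_eq_rpow, ← Real.rpow_mul hw.le]
  ring_nf

/-- `K_{1/2}` is elementary; this is the case `ν = -1/2` of that fact in terms of `besselW`. -/
lemma besselW_neg_half {τ : ℝ} (hτ : 0 < τ) :
    besselW (-(1 / 2)) (τ ^ 2) = √(Real.pi / 2) * (Real.exp (-τ) / τ) := by
  have hK : besselK (1 / 2) τ = √(Real.pi / (2 * τ)) * Real.exp (-τ) := by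
    have hd : ∀ t : ℝ, HasDerivAt (fun t => Real.sinh (t / 2)) (Real.cosh (t / 2) * (1 / 2)) t :=
      fun t => ((hasDerivAt_id t).div_const 2).sinh
    have htop : Tendsto (fun t : ℝ => Real.sinh (t / 2)) atTop atTop := by
      refine tendsto_atTop_mono' _ ?_ (tendsto_id.atTop_div_const (zero_lt_two' ℝ))
      filter_upwards [eventually_ge_atTop 0] with t ht
      exact Real.self_le_sinh_iff.2 (by positivity)
    have hsub := integral_comp_mul_deriv_Ioi (a := 0) (f := fun t => Real.sinh (t / 2))
      (f' := fun t => Real.cosh (t / 2) * (1 / 2))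
      (g := fun s => Real.exp (-(2 * τ) * s ^ 2)) (by fun_prop) htop
      (fun t _ => (hd t).hasDerivWithinAt) (by fun_prop)
      ((integrable_exp_neg_mul_sq (by positivity)).integrableOn) ?_
    · have hg := integral_gaussian_Ioi (2 * τ)
      have h0 : Real.sinh (0 / 2) = 0 := by simp
      rw [h0, hg] at hsub
      have : besselK (1 / 2) τ = ∫ t in Ioi (0 : ℝ), (2 * Real.exp (-τ)) *
          (((fun s => Real.exp (-(2 * τ) * s ^ 2)) ∘ fun t => Real.sinh (t / 2)) t
            * (Real.cosh (t / 2) * (1 / 2))) := by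
        rw [besselK]
        refine integral_congr_ae (ae_of_all _ fun t => ?_)
        simp only [Function.comp]
        rw [cosh_eq_one_add_two_mul_sinh_sq t, show -τ * (1 + 2 * Real.sinh (t / 2) ^ 2)
          = -τ + -(2 * τ) * Real.sinh (t / 2) ^ 2 by ring, Real.exp_add,
          show 1 / 2 * t = t / 2 by ring]
        ring
      rw [this, integral_const_mul, hsub]
      ring
    · have h := integrable_exp_neg_cosh (1 / 2) hτ
      have h' := integrable_exp_neg_cosh (-(1 / 2)) hτ
      refine (((h.add h').const_mul (Real.exp τ / 4)).integrableOn).congr_fun (fun t _ => ?_)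
        measurableSet_Ici
      simp only [Function.comp, Pi.add_apply]
      rw [cosh_eq_one_add_two_mul_sinh_sq t, Real.cosh_eq (t / 2), Real.exp_add, Real.exp_add,
        show -τ * (1 + 2 * Real.sinh (t / 2) ^ 2)
          = -τ + -(2 * τ) * Real.sinh (t / 2) ^ 2 by ring, Real.exp_add, Real.exp_neg τ]
      field_simp
      ring_nf
  rw [besselW, besselK_neg, Real.sqrt_sq hτ.le, hK, ← Real.rpow_natCast τ 2,
    ← Real.rpow_mul hτ.le, show Real.pi / (2 * τ) = Real.pi / 2 / τ by field_simp,
    Real.sqrt_div (by positivity), Real.sqrt_eq_rpow τ,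
    show ((2 : ℕ) : ℝ) * (-(1 / 2) / 2) = -(1 / 2) by norm_num, Real.rpow_neg hτ.le]
  have : τ ^ (1 / 2 : ℝ) * τ ^ (1 / 2 : ℝ) = τ := by
    rw [← Real.rpow_add hτ]; norm_num
  have h2 : 0 < τ ^ (1 / 2 : ℝ) := by positivity
  field_simp
  nlinarith

/-! ### A holomorphic integral on a wide sector -/

/-- The open sector `|arg y| < π - arctan (1 / 2)`, on which `1 + s * y` stays away from `0`
for `s ≥ 0`. It contains a sector of opening larger than `π`. -/
def wideSector : Set ℂ := {y | -(2 * |y.im|) < y.re}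

lemma isOpen_wideSector : IsOpen wideSector :=
  isOpen_lt (by fun_prop) (by fun_prop)

lemma ofReal_mem_wideSector {x : ℝ} (hx : 0 < x) : (x : ℂ) ∈ wideSector := by
  simpa [wideSector] using hx

lemma wideSector_subset_slitPlane : wideSector ⊆ Complex.slitPlane := by
  intro y hy
  rw [Complex.mem_slitPlane_iff]
  by_cases h : y.im = 0
  · left; simpa [wideSector, h] using hy
  · exact Or.inr h

lemma inv_mem_wideSector {y : ℂ} (hy : y ∈ wideSector) : y⁻¹ ∈ wideSector := by
  have h0 : 0 < Complex.normSq y :=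
    Complex.normSq_pos.2 (Complex.slitPlane_ne_zero (wideSector_subset_slitPlane hy))
  simp only [wideSector, mem_ofPred_eq, Complex.inv_re, Complex.inv_im, abs_div, abs_neg,
    abs_of_pos h0] at hy ⊢
  rw [← mul_div_assoc, ← neg_div]
  exact div_lt_div_of_pos_right hy h0

lemma real_mul_mem_wideSector {y : ℂ} (hy : y ∈ wideSector) {c : ℝ} (hc : 0 < c) :
    (c : ℂ) * y ∈ wideSector := by
  simp only [wideSector, mem_ofPred_eq, Complex.re_ofReal_mul, Complex.im_ofReal_mul, abs_mul,
    abs_of_pos hc] at hy ⊢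
  nlinarith

lemma one_add_mul_mem_slitPlane {y : ℂ} (hy : y ∈ wideSector) {s : ℝ} (hs : 0 < s) :
    1 + (s : ℂ) * y ∈ Complex.slitPlane := by
  rw [Complex.mem_slitPlane_iff]
  by_cases h : y.im = 0
  · left
    have : 0 < y.re := by simpa [wideSector, h] using hy
    simp only [Complex.add_re, Complex.one_re, Complex.re_ofReal_mul]
    positivity
  · right
    simp [h, hs.ne']

lemma two_fifths_le_norm_one_add_mul {y : ℂ} (hy : y ∈ wideSector) {s : ℝ} (hs : 0 < s) :
    2 / 5 ≤ ‖1 + (s : ℂ) * y‖ := by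
  have hy' : -(2 * |y.im|) < y.re := hy
  have h : (2 / 5 : ℝ) ^ 2 ≤ ‖1 + (s : ℂ) * y‖ ^ 2 := by
    rw [← Complex.normSq_eq_norm_sq, Complex.normSq_apply]
    simp only [Complex.add_re, Complex.one_re, Complex.re_ofReal_mul, Complex.add_im,
      Complex.one_im, Complex.im_ofReal_mul, zero_add]
    rcases le_or_gt 0 y.re with h0 | h0
    · nlinarith [mul_nonneg hs.le h0, mul_self_nonneg (s * y.im)]
    · have h1 : y.re ^ 2 ≤ 4 * y.im ^ 2 := by
        rw [← sq_abs y.im]; nlinarith [abs_nonneg y.im]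
      nlinarith [mul_le_mul_of_nonneg_left h1 (sq_nonneg s), sq_nonneg (5 * (s * y.re) + 4)]
  exact (abs_le_of_sq_le_sq' h (norm_nonneg _)).2

lemma norm_one_add_mul_le {y : ℂ} {X s : ℝ} (hX : 1 ≤ X) (hy : ‖y‖ ≤ X) (hs : 0 < s) :
    ‖1 + (s : ℂ) * y‖ ≤ X * (1 + s) := by
  refine (norm_add_le _ _).trans ?_
  rw [norm_one, norm_mul, Complex.norm_real, Real.norm_of_nonneg hs.le]
  nlinarith

lemma rpow_le_rpow_abs {x X : ℝ} (hx : 0 < x) (h1 : x ≤ X) (h2 : x⁻¹ ≤ X) (e : ℝ) :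
    x ^ e ≤ X ^ |e| := by
  rcases le_total 0 e with he | he
  · rw [abs_of_nonneg he]; exact Real.rpow_le_rpow hx.le h1 he
  · rw [abs_of_nonpos he, show x ^ e = (x⁻¹) ^ (-e) by
      rw [Real.inv_rpow hx.le, Real.rpow_neg hx.le, inv_inv]]
    exact Real.rpow_le_rpow (by positivity) h2 (by linarith)

lemma norm_one_add_mul_cpow_le {y : ℂ} (hy : y ∈ wideSector) {X s : ℝ} (hX : 5 / 2 ≤ X)
    (hyX : ‖y‖ ≤ X) (hs : 0 < s) (e : ℝ) :
    ‖(1 + (s : ℂ) * y) ^ (e : ℂ)‖ ≤ X ^ |e| * (1 + s) ^ |e| := by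
  have h0 := two_fifths_le_norm_one_add_mul hy hs
  rw [Complex.norm_cpow_real, ← Real.mul_rpow (by linarith) (by linarith)]
  refine rpow_le_rpow_abs (by linarith) (norm_one_add_mul_le (by linarith) hyX hs) ?_ e
  refine (inv_anti₀ (by norm_num) h0).trans ?_
  nlinarith

/-- The Gamma integrand `exp (-s) * s ^ (a - 1)`. -/
def gammaWeight (a s : ℝ) : ℝ := Real.exp (-s) * s ^ (a - 1)

lemma gammaWeight_pos (a : ℝ) {s : ℝ} (hs : 0 < s) : 0 < gammaWeight a s := by
  unfold gammaWeight; positivity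

lemma measurable_gammaWeight (a : ℝ) : Measurable (gammaWeight a) := by
  unfold gammaWeight; fun_prop

lemma integrableOn_gammaWeight_mul_rpow {a : ℝ} (ha : 0 < a) {m : ℝ} (hm : 0 ≤ m) :
    IntegrableOn (fun s => gammaWeight a s * (1 + s) ^ m) (Ioi 0) := by
  have h1 := Real.GammaIntegral_convergent ha
  have h2 := Real.GammaIntegral_convergent (add_pos_of_pos_of_nonneg ha hm)
  refine Integrable.mono' ((h1.add h2).const_mul (2 ^ m))
    ((measurable_gammaWeight a).mul (by fun_prop)).aestronglyMeasurable ?_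
  filter_upwards [ae_restrict_mem measurableSet_Ioi] with s hs
  have hs : 0 < s := hs
  rw [Real.norm_of_nonneg (mul_nonneg (gammaWeight_pos a hs).le (by positivity))]
  have key : (1 + s) ^ m ≤ 2 ^ m * (1 + s ^ m) := by
    rcases le_total s 1 with h | h
    · have : (1 + s) ^ m ≤ 2 ^ m := Real.rpow_le_rpow (by positivity) (by linarith) hm
      have h3 : 0 ≤ s ^ m := by positivity
      have h4 : (0 : ℝ) < 2 ^ m := by positivity
      nlinarith [mul_nonneg h4.le h3]
    · have : (1 + s) ^ m ≤ (2 * s) ^ m := Real.rpow_le_rpow (by positivity) (by linarith) hm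
      rw [Real.mul_rpow (by norm_num) hs.le] at this
      have h4 : (0 : ℝ) < 2 ^ m := by positivity
      linarith
  refine (mul_le_mul_of_nonneg_left key (gammaWeight_pos a hs).le).trans (le_of_eq ?_)
  simp only [gammaWeight, Pi.add_apply]
  rw [show a + m - 1 = (a - 1) + m by ring, Real.rpow_add hs]
  ring

/-- The function `y ↦ ∫_0^∞ exp (-s) s ^ (a - 1) (1 + s y) ^ (a - 1) ds`, holomorphic on
`wideSector`. With `a = κ + 1 / 2` and `y = 1 / (2 z)` it is, up to the factor `Γ(a)`, the
quotient of `K_κ(z)` by its leading asymptotic term `√(π / (2 z)) * exp (-z)`. -/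
def besselL (a : ℝ) (y : ℂ) : ℂ :=
  ∫ s in Ioi (0 : ℝ), (gammaWeight a s : ℂ) * (1 + (s : ℂ) * y) ^ ((a - 1 : ℝ) : ℂ)

lemma measurable_one_add_mul_cpow (y : ℂ) (e : ℂ) :
    Measurable fun s : ℝ => (1 + (s : ℂ) * y) ^ e := by
  fun_prop

/-- The integrand of `besselL` is dominated uniformly on bounded parts of `wideSector`. -/
lemma norm_besselL_integrand_le {y : ℂ} (hy : y ∈ wideSector) {X s : ℝ} (hX : 5 / 2 ≤ X)
    (hyX : ‖y‖ ≤ X) (hs : 0 < s) (a e : ℝ) :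
    ‖(gammaWeight a s : ℂ) * (1 + (s : ℂ) * y) ^ (e : ℂ)‖
      ≤ X ^ |e| * (gammaWeight a s * (1 + s) ^ |e|) := by
  rw [norm_mul, Complex.norm_real, Real.norm_of_nonneg (gammaWeight_pos a hs).le]
  have := mul_le_mul_of_nonneg_left (norm_one_add_mul_cpow_le hy hX hyX hs e)
    (gammaWeight_pos a hs).le
  linarith

lemma norm_besselL_le {a : ℝ} (ha : 0 < a) {X : ℝ} (hX : 5 / 2 ≤ X) :
    ∃ C, 0 ≤ C ∧ ∀ y ∈ wideSector, ‖y‖ ≤ X → ‖besselL a y‖ ≤ C := by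
  refine ⟨∫ s in Ioi (0 : ℝ), X ^ |a - 1| * (gammaWeight a s * (1 + s) ^ |a - 1|), ?_, ?_⟩
  · refine setIntegral_nonneg measurableSet_Ioi fun s hs => ?_
    have hs : 0 < s := hs
    have := gammaWeight_pos a hs
    have : 0 ≤ X := by linarith
    positivity
  · intro y hy hyX
    refine norm_integral_le_of_norm_le
      ((integrableOn_gammaWeight_mul_rpow ha (abs_nonneg _)).const_mul _) ?_
    filter_upwards [ae_restrict_mem measurableSet_Ioi] with s hs
    exact norm_besselL_integrand_le hy hX hyX hs a (a - 1)

lemma differentiableOn_besselL {a : ℝ} (ha : 0 < a) :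
    DifferentiableOn ℂ (besselL a) wideSector := by
  intro y₀ hy₀
  set X : ℝ := max (5 / 2) (‖y₀‖ + 1) with hXdef
  have hX : 5 / 2 ≤ X := le_max_left _ _
  have hS : wideSector ∩ Metric.ball y₀ 1 ∈ 𝓝 y₀ :=
    inter_mem (isOpen_wideSector.mem_nhds hy₀) (Metric.ball_mem_nhds _ one_pos)
  have hle : ∀ y ∈ wideSector ∩ Metric.ball y₀ 1, ‖y‖ ≤ X := fun y hy => by
    have h1 : ‖y - y₀‖ < 1 := by simpa [dist_eq_norm] using hy.2
    have := norm_le_norm_add_norm_sub' y y₀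
    exact le_max_of_le_right (by linarith)
  have hmeas : ∀ (y e : ℂ), AEStronglyMeasurable
      (fun s : ℝ => (gammaWeight a s : ℂ) * (1 + (s : ℂ) * y) ^ e)
      (volume.restrict (Ioi 0)) := fun y e =>
    ((Complex.measurable_ofReal.comp (measurable_gammaWeight a)).mul
      (measurable_one_add_mul_cpow y e)).aestronglyMeasurable
  refine ((hasDerivAt_integral_of_dominated_loc_of_deriv_le (μ := volume.restrict (Ioi (0 : ℝ)))
    (F := fun y s => (gammaWeight a s : ℂ) * (1 + (s : ℂ) * y) ^ ((a - 1 : ℝ) : ℂ))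
    (F' := fun y s => (gammaWeight a s : ℂ) *
      (((a - 1 : ℝ) : ℂ) * (1 + (s : ℂ) * y) ^ (((a - 1 : ℝ) : ℂ) - 1) * s))
    (bound := fun s => |a - 1| * X ^ |a - 2| * (gammaWeight a s * (1 + s) ^ (|a - 2| + 1)))
    hS ?_ ?_ ?_ ?_ ?_ ?_).2).differentiableAt.differentiableWithinAt
  · exact Eventually.of_forall fun y => hmeas y _
  · refine Integrable.mono' ((integrableOn_gammaWeight_mul_rpow ha (abs_nonneg (a - 1))).const_mul
      (X ^ |a - 1|)) (hmeas _ _) ?_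
    filter_upwards [ae_restrict_mem measurableSet_Ioi] with s hs
    exact norm_besselL_integrand_le hy₀ hX (hle y₀ ⟨hy₀, Metric.mem_ball_self one_pos⟩) hs a _
  · refine ((Complex.measurable_ofReal.comp (measurable_gammaWeight a)).mul
      (((measurable_one_add_mul_cpow y₀ _).const_mul _).mul
        Complex.measurable_ofReal)).aestronglyMeasurable
  · filter_upwards [ae_restrict_mem measurableSet_Ioi] with s hs y hy
    have hs : 0 < s := hs
    have h := norm_besselL_integrand_le hy.1 hX (hle y hy) hs a (a - 2)
    rw [show ((a - 1 : ℝ) : ℂ) - 1 = ((a - 2 : ℝ) : ℂ) by push_cast; ring,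
      show (gammaWeight a s : ℂ) * (((a - 1 : ℝ) : ℂ) * (1 + (s : ℂ) * y) ^ ((a - 2 : ℝ) : ℂ) * s)
        = ((a - 1 : ℝ) : ℂ) * (s : ℂ) *
          ((gammaWeight a s : ℂ) * (1 + (s : ℂ) * y) ^ ((a - 2 : ℝ) : ℂ)) by ring,
      norm_mul, norm_mul, Complex.norm_real, Complex.norm_real, Real.norm_of_nonneg hs.le,
      Real.norm_eq_abs, Real.rpow_add (by linarith), Real.rpow_one]
    have h3 : 0 ≤ X ^ |a - 2| * (gammaWeight a s * (1 + s) ^ |a - 2|) :=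
      (norm_nonneg _).trans h
    calc |a - 1| * s * ‖(gammaWeight a s : ℂ) * (1 + (s : ℂ) * y) ^ ((a - 2 : ℝ) : ℂ)‖
        ≤ |a - 1| * (1 + s) * (X ^ |a - 2| * (gammaWeight a s * (1 + s) ^ |a - 2|)) := by
          gcongr; linarith
      _ = _ := by ring
  · exact (integrableOn_gammaWeight_mul_rpow ha (by positivity)).const_mul _
  · filter_upwards [ae_restrict_mem measurableSet_Ioi] with s hs y hy
    have h1 : HasDerivAt (fun y : ℂ => 1 + (s : ℂ) * y) (s : ℂ) y := by
      simpa using ((hasDerivAt_id y).const_mul (s : ℂ)).const_add 1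
    exact (h1.cpow_const (one_add_mul_mem_slitPlane hy.1 hs)).const_mul _

/-- The limit of `besselL a` at `0` along the positive reals. -/
lemma tendsto_besselL_zero {a : ℝ} (ha : 0 < a) :
    Tendsto (fun x : ℝ => besselL a x) (𝓝[>] 0) (𝓝 (Real.Gamma a : ℂ)) := by
  have hG : (Real.Gamma a : ℂ) = ∫ s in Ioi (0 : ℝ), (gammaWeight a s : ℂ) := by
    rw [integral_complex_ofReal, Real.Gamma_eq_integral ha]; rfl
  rw [hG]
  refine tendsto_integral_filter_of_dominated_convergence
    (fun s => (5 / 2) ^ |a - 1| * (gammaWeight a s * (1 + s) ^ |a - 1|)) ?_ ?_ ?_ ?_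
  · exact Eventually.of_forall fun y => ((Complex.measurable_ofReal.comp
      (measurable_gammaWeight a)).mul (measurable_one_add_mul_cpow y _)).aestronglyMeasurable
  · filter_upwards [self_mem_nhdsWithin,
      mem_nhdsWithin_of_mem_nhds (Iio_mem_nhds (zero_lt_one' ℝ))] with x hx hx1
    have hx : 0 < x := hx
    have hx1 : x < 1 := hx1
    filter_upwards [ae_restrict_mem measurableSet_Ioi] with s hs
    refine norm_besselL_integrand_le (ofReal_mem_wideSector hx) le_rfl ?_ hs a (a - 1)
    rw [Complex.norm_real, Real.norm_of_nonneg hx.le]; linarith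
  · exact (integrableOn_gammaWeight_mul_rpow ha (abs_nonneg _)).const_mul _
  · refine ae_of_all _ fun s => ?_
    have h : ContinuousAt (fun x : ℝ => (gammaWeight a s : ℂ) *
        (1 + (s : ℂ) * x) ^ ((a - 1 : ℝ) : ℂ)) 0 := by
      refine continuousAt_const.mul (ContinuousAt.cpow (by fun_prop) continuousAt_const ?_)
      simp
    have h2 := h.tendsto
    simp only [Complex.ofReal_zero, mul_zero, add_zero, Complex.one_cpow, mul_one] at h2
    exact h2.mono_left nhdsWithin_le_nhds

/-! ### Schläfli's integral representation -/

lemma besselWKernel_pos (ν w t : ℝ) : 0 < besselWKernel ν w t := Real.exp_pos _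

lemma besselWKernel_add (ν w v t : ℝ) :
    besselWKernel ν (w + v) t = besselWKernel ν w t * Real.exp (-(Real.exp (-t) / 2 * v)) := by
  rw [besselWKernel, besselWKernel, ← Real.exp_add]; ring_nf

lemma integral_rpow_mul_besselWKernel {a : ℝ} (ha : 0 < a) (ν w t : ℝ) :
    ∫ v in Ioi (0 : ℝ), v ^ (a - 1) * besselWKernel ν (w + v) t
      = 2 ^ a * Real.Gamma a * besselWKernel (ν + a) w t := by
  have h := Real.integral_rpow_mul_exp_neg_mul_Ioi ha (half_pos (Real.exp_pos (-t)))
  have h2 : ∀ v : ℝ, v ^ (a - 1) * besselWKernel ν (w + v) t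
      = besselWKernel ν w t * (v ^ (a - 1) * Real.exp (-(Real.exp (-t) / 2 * v))) := fun v => by
    rw [besselWKernel_add]; ring
  simp_rw [h2]
  rw [integral_const_mul, h, one_div_div, Real.div_rpow (by norm_num) (Real.exp_pos _).le,
    ← Real.exp_mul, neg_mul, Real.exp_neg, div_inv_eq_mul, besselWKernel, besselWKernel,
    show (ν + a) * t - Real.exp t / 2 - w / 2 * Real.exp (-t)
      = (ν * t - Real.exp t / 2 - w / 2 * Real.exp (-t)) + t * a by ring, Real.exp_add]
  ring

lemma integrableOn_rpow_mul_besselWKernel {a : ℝ} (ha : 0 < a) (ν w t : ℝ) :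
    IntegrableOn (fun v => v ^ (a - 1) * besselWKernel ν (w + v) t) (Ioi 0) := by
  -- the integral is nonzero, hence not the junk value of a non-integrable function
  by_contra h
  have h1 := integral_undef h
  rw [integral_rpow_mul_besselWKernel ha] at h1
  have := besselWKernel_pos (ν + a) w t
  have := Real.Gamma_pos_of_pos ha
  have : 0 < 2 ^ a * Real.Gamma a * besselWKernel (ν + a) w t := by positivity
  exact this.ne' h1

lemma integrable_rpow_mul_besselWKernel_prod {a w : ℝ} (ha : 0 < a) (hw : 0 < w) (ν : ℝ) :
    Integrable (Function.uncurry fun v t : ℝ => v ^ (a - 1) * besselWKernel ν (w + v) t)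
      ((volume.restrict (Ioi (0 : ℝ))).prod volume) := by
  have hm : Measurable
      (Function.uncurry fun v t : ℝ => v ^ (a - 1) * besselWKernel ν (w + v) t) := by
    unfold besselWKernel Function.uncurry; fun_prop
  refine (integrable_prod_iff' hm.aestronglyMeasurable).2
    ⟨ae_of_all _ fun t => integrableOn_rpow_mul_besselWKernel ha ν w t, ?_⟩
  refine ((integrable_besselWKernel (ν + a) hw).const_mul (2 ^ a * Real.Gamma a)).congr
    (ae_of_all _ fun t => ?_)
  simp only
  rw [← integral_rpow_mul_besselWKernel ha]
  refine setIntegral_congr_fun measurableSet_Ioi fun v hv => ?_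
  have hv : 0 < v := hv
  exact (Real.norm_of_nonneg (mul_nonneg (by positivity) (besselWKernel_pos _ _ _).le)).symm

/-- Raising the index of `besselW` by a fractional integral in its argument. -/
lemma integral_rpow_mul_besselW {a w : ℝ} (ha : 0 < a) (hw : 0 < w) (ν : ℝ) :
    ∫ v in Ioi (0 : ℝ), v ^ (a - 1) * besselW ν (w + v)
      = 2 ^ a * Real.Gamma a * besselW (ν + a) w := by
  have h := integral_integral_swap (integrable_rpow_mul_besselWKernel_prod ha hw ν)
  simp_rw [integral_rpow_mul_besselWKernel ha, integral_const_mul] at h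
  rw [besselW_eq_integral _ hw, mul_left_comm, ← h, ← integral_const_mul]
  refine setIntegral_congr_fun measurableSet_Ioi fun v hv => ?_
  have hv : 0 < v := hv
  rw [besselW_eq_integral _ (by positivity)]
  ring

lemma integrableOn_rpow_mul_besselW {a w : ℝ} (ha : 0 < a) (hw : 0 < w) (ν : ℝ) :
    IntegrableOn (fun v => v ^ (a - 1) * besselW ν (w + v)) (Ioi 0) := by
  have h := ((integrable_rpow_mul_besselWKernel_prod ha hw ν).integral_prod_left).const_mul (1 / 2)
  refine IntegrableOn.congr_fun h (fun v hv => ?_) measurableSet_Ioi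
  have hv : 0 < v := hv
  simp only [Function.uncurry]
  rw [besselW_eq_integral _ (by positivity), integral_const_mul]
  ring

lemma besselL_ofReal {a x : ℝ} (hx : 0 < x) :
    besselL a x = ((∫ s in Ioi (0 : ℝ), gammaWeight a s * (1 + s * x) ^ (a - 1) : ℝ) : ℂ) := by
  rw [← integral_complex_ofReal, besselL]
  refine setIntegral_congr_fun measurableSet_Ioi fun s hs => ?_
  have hs : 0 < s := hs
  rw [Complex.ofReal_mul, Complex.ofReal_cpow (by positivity)]
  push_cast
  rfl

lemma integrableOn_gammaWeight_mul {a x : ℝ} (ha : 0 < a) (hx : 0 < x) :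
    IntegrableOn (fun s => gammaWeight a s * (1 + s * x) ^ (a - 1)) (Ioi 0) := by
  set X : ℝ := max (5 / 2) x
  have hX : 5 / 2 ≤ X := le_max_left _ _
  refine Integrable.mono' ((integrableOn_gammaWeight_mul_rpow ha (abs_nonneg (a - 1))).const_mul
      (X ^ |a - 1|)) ((measurable_gammaWeight a).mul (by fun_prop)).aestronglyMeasurable ?_
  filter_upwards [ae_restrict_mem measurableSet_Ioi] with s hs
  have hs : 0 < s := hs
  have h := norm_besselL_integrand_le (ofReal_mem_wideSector hx) hX
    (by rw [Complex.norm_real, Real.norm_of_nonneg hx.le]; exact le_max_right _ _) hs a (a - 1)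
  convert! h using 1
  rw [norm_mul, norm_mul, Complex.norm_real, Complex.norm_cpow_real]
  congr 1
  rw [Real.norm_of_nonneg (by positivity)]
  congr 1
  rw [← Complex.ofReal_mul, ← Complex.ofReal_one, ← Complex.ofReal_add, Complex.norm_real,
    Real.norm_of_nonneg (by positivity)]

/-- Schläfli's representation of `K_{a - 1/2}`. The substitution `v = s ^ 2 + 2 * z * s` turns the
integral `besselL` into a fractional integral of `K_{1/2}`, which is elementary. -/
lemma besselL_eq_besselW {a z : ℝ} (ha : 0 < a) (hz : 0 < z) :
    besselL a ((1 / (2 * z) : ℝ) : ℂ)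
      = ((2 ^ a * Real.Gamma a / (2 * √(Real.pi / 2)) * (2 * z) ^ (1 - a) * Real.exp z
          * besselW (a - 1 / 2) (z ^ 2) : ℝ) : ℂ) := by
  rw [besselL_ofReal (by positivity)]
  congr 1
  have hd : ∀ s : ℝ, HasDerivAt (fun s : ℝ => s ^ 2 + 2 * z * s) (2 * (z + s)) s := fun s => by
    have h := ((hasDerivAt_id s).pow 2).add ((hasDerivAt_id s).const_mul (2 * z))
    refine h.congr_deriv ?_
    simp; ring
  have hsq : ∀ s : ℝ, z ^ 2 + (s ^ 2 + 2 * z * s) = (z + s) ^ 2 := fun s => by ring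
  set g : ℝ → ℝ := fun v => v ^ (a - 1) * besselW (-(1 / 2)) (z ^ 2 + v) with hg
  have hcomp : ∀ s : ℝ, 0 < s → (g ∘ fun s : ℝ => s ^ 2 + 2 * z * s) s * (2 * (z + s))
      = (2 * √(Real.pi / 2) * (2 * z) ^ (a - 1) * Real.exp (-z))
        * (gammaWeight a s * (1 + s * (1 / (2 * z))) ^ (a - 1)) := fun s hs => by
    have hzs : 0 < z + s := by positivity
    simp only [hg, Function.comp, gammaWeight]
    rw [hsq, besselW_neg_half hzs, show s ^ 2 + 2 * z * s = (2 * z) * s * (1 + s * (1 / (2 * z))) by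
      field_simp; ring, Real.mul_rpow (by positivity) (by positivity),
      Real.mul_rpow (by positivity) (by positivity), neg_add, Real.exp_add]
    field_simp
  have himg : (fun s : ℝ => s ^ 2 + 2 * z * s) '' Ici 0 ⊆ Ici 0 := by
    rintro _ ⟨s, hs, rfl⟩
    have hs : 0 ≤ s := hs
    simp only [mem_Ici]; positivity
  have himg' : (fun s : ℝ => s ^ 2 + 2 * z * s) '' Ioi 0 ⊆ Ioi 0 := by
    rintro _ ⟨s, hs, rfl⟩
    have hs : 0 < s := hs
    simp only [mem_Ioi]; positivity
  have hgi : IntegrableOn g (Ioi 0) := integrableOn_rpow_mul_besselW ha (by positivity) _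
  have hcont : ContinuousOn g (Ioi 0) := by
    have : EqOn g (fun v => v ^ (a - 1) *
        (√(Real.pi / 2) * (Real.exp (-√(z ^ 2 + v)) / √(z ^ 2 + v)))) (Ioi 0) := fun v hv => by
      have hv : 0 < v := hv
      simp only [hg]
      rw [← besselW_neg_half (Real.sqrt_pos.2 (by positivity)), Real.sq_sqrt (by positivity)]
    refine ContinuousOn.congr ?_ this
    intro v hv
    have hv : 0 < v := hv
    have h1 : √(z ^ 2 + v) ≠ 0 := (Real.sqrt_pos.2 (by positivity)).ne'
    have h2 : v ≠ 0 := hv.ne'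
    refine ContinuousAt.continuousWithinAt ?_
    refine (Real.continuousAt_rpow_const _ _ (Or.inl h2)).mul (continuousAt_const.mul ?_)
    exact ContinuousAt.div (by fun_prop) (by fun_prop) h1
  have hsub := integral_comp_mul_deriv_Ioi (a := 0) (f := fun s : ℝ => s ^ 2 + 2 * z * s)
    (f' := fun s => 2 * (z + s)) (g := g) (by fun_prop)
    (by
      refine tendsto_atTop_mono' _ ?_ (tendsto_id.const_mul_atTop (show 0 < 2 * z by positivity))
      exact Eventually.of_forall fun s => by simp only [id]; nlinarith [sq_nonneg s])
    (fun s _ => (hd s).hasDerivWithinAt) (hcont.mono himg')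
    (((integrableOn_Ici_iff_integrableOn_Ioi enorm_ne_top).2 hgi).mono_set himg)
    ((integrableOn_Ici_iff_integrableOn_Ioi enorm_ne_top).2
      (IntegrableOn.congr_fun
        ((integrableOn_gammaWeight_mul (x := 1 / (2 * z)) ha (by positivity)).const_mul _)
        (fun s hs => (hcomp s hs).symm) measurableSet_Ioi))
  rw [setIntegral_congr_fun measurableSet_Ioi (fun s hs => hcomp s hs), integral_const_mul,
    show (0 : ℝ) ^ 2 + 2 * z * 0 = 0 by ring, hg, integral_rpow_mul_besselW ha (by positivity),
    show -(1 / 2) + a = a - 1 / 2 by ring] at hsub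
  have h2z : (0 : ℝ) < (2 * z) ^ (a - 1) := by positivity
  have hpi : 0 < √(Real.pi / 2) := Real.sqrt_pos.2 (by positivity)
  have hez := Real.exp_pos z
  rw [Real.exp_neg] at hsub
  rw [show 1 - a = -(a - 1) by ring, Real.rpow_neg (by positivity)]
  field_simp at hsub ⊢
  linarith

/-! ### Asymptotics and analyticity -/

lemma besselW_sq {ν z : ℝ} (hz : 0 < z) : besselW ν (z ^ 2) = z ^ ν * besselK ν z := by
  rw [besselW, Real.sqrt_sq hz.le, ← Real.rpow_natCast z 2, ← Real.rpow_mul hz.le]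
  norm_num [mul_div_cancel₀]

/-- The factorization of `besselW` into its leading asymptotic term and the function `besselL`. -/
lemma besselW_sq_eq_besselL (ν : ℝ) {z : ℝ} (hz : 0 < z) :
    (besselW ν (z ^ 2) : ℂ) = ((√(Real.pi / 2) / Real.Gamma (|ν| + 1 / 2)
      * z ^ (ν - 1 / 2) * Real.exp (-z) : ℝ) : ℂ)
        * besselL (|ν| + 1 / 2) ((1 / (2 * z) : ℝ) : ℂ) := by
  have ha : 0 < |ν| + 1 / 2 := by positivity
  have hG := Real.Gamma_pos_of_pos ha
  have hpi : 0 < √(Real.pi / 2) := Real.sqrt_pos.2 (by positivity)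
  have hK : besselK |ν| z = besselK ν z := by
    rcases abs_choice ν with h | h <;> rw [h]
    exact besselK_neg ν z
  rw [besselL_eq_besselW ha hz, ← Complex.ofReal_mul]
  congr 1
  rw [add_sub_cancel_right, besselW_sq hz, besselW_sq hz, hK,
    show 1 - (|ν| + 1 / 2) = 1 / 2 - |ν| by ring, Real.mul_rpow (by norm_num) hz.le,
    Real.exp_neg]
  have h1 : z ^ (ν - 1 / 2) * (z ^ (1 / 2 - |ν|) * z ^ |ν|) = z ^ ν := by
    rw [← Real.rpow_add hz, ← Real.rpow_add hz]; ring_nf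
  have h2 : (2 : ℝ) ^ (|ν| + 1 / 2) * 2 ^ (1 / 2 - |ν|) = 2 := by
    rw [← Real.rpow_add (by norm_num), show |ν| + 1 / 2 + (1 / 2 - |ν|) = 1 by ring, Real.rpow_one]
  rw [← h1]
  have hez := Real.exp_pos z
  generalize (2 : ℝ) ^ (|ν| + 1 / 2) = X at *
  generalize (2 : ℝ) ^ (1 / 2 - |ν|) = Y at *
  field_simp
  linear_combination (-besselK ν z) * h2

/-- The leading asymptotics of the Bessel function at infinity. -/
lemma tendsto_besselW_sq (ν : ℝ) :
    Tendsto (fun z : ℝ => besselW ν (z ^ 2) * (z ^ (1 / 2 - ν) * Real.exp z)) atTop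
      (𝓝 √(Real.pi / 2)) := by
  have ha : 0 < |ν| + 1 / 2 := by positivity
  have hG := Real.Gamma_pos_of_pos ha
  have h1 : Tendsto (fun z : ℝ => 1 / (2 * z)) atTop (𝓝[>] 0) := by
    refine (tendsto_inv_atTop_nhdsGT_zero.comp
      (tendsto_id.const_mul_atTop (zero_lt_two' ℝ))).congr fun z => ?_
    simp
  have h2 := ((Complex.continuous_re.tendsto _).comp ((tendsto_besselL_zero ha).comp h1)).const_mul
    (√(Real.pi / 2) / Real.Gamma (|ν| + 1 / 2))
  rw [Complex.ofReal_re, div_mul_cancel₀ _ hG.ne'] at h2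
  refine h2.congr' ?_
  filter_upwards [eventually_gt_atTop 0] with z hz
  have h3 := congrArg Complex.re (besselW_sq_eq_besselL ν hz)
  rw [Complex.ofReal_re, Complex.re_ofReal_mul] at h3
  rw [h3]
  have h4 : z ^ (ν - 1 / 2) * z ^ (1 / 2 - ν) = 1 := by
    rw [← Real.rpow_add hz]; norm_num
  have h5 : Real.exp (-z) * Real.exp z = 1 := by rw [← Real.exp_add]; simp
  have h6 : z ^ (ν - 1 / 2) * Real.exp (-z) * (z ^ (1 / 2 - ν) * Real.exp z) = 1 := by
    rw [mul_mul_mul_comm, h4, h5, one_mul]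
  simp only [Function.comp]
  linear_combination (-(√(Real.pi / 2) / Real.Gamma (|ν| + 1 / 2) *
    (besselL (|ν| + 1 / 2) ((1 / (2 * z) : ℝ) : ℂ)).re)) * h6

lemma analyticAt_besselW (ν : ℝ) {w : ℝ} (hw : 0 < w) : AnalyticAt ℝ (besselW ν) w := by
  have ha : 0 < |ν| + 1 / 2 := by positivity
  set k : ℝ := √(Real.pi / 2) / Real.Gamma (|ν| + 1 / 2) with hk
  set r : ℂ → ℂ := fun ζ => ζ ^ ((1 / 2 : ℝ) : ℂ) with hr
  have hrw : ∀ x : ℝ, 0 < x → r x = (√x : ℝ) := fun x hx => by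
    rw [hr, Real.sqrt_eq_rpow, Complex.ofReal_cpow hx.le]
  have hslit : (w : ℂ) ∈ Complex.slitPlane := Complex.ofReal_mem_slitPlane.2 hw
  have hra : AnalyticAt ℂ r w := analyticAt_id.cpow analyticAt_const hslit
  have hsw := Real.sqrt_pos.2 hw
  have hr0 : (2 : ℂ) * r w ≠ 0 := by
    rw [hrw w hw]; exact_mod_cast (mul_pos two_pos hsw).ne'
  have hmem : 1 / (2 * r w) ∈ wideSector := by
    rw [hrw w hw]
    have := ofReal_mem_wideSector (show (0 : ℝ) < 1 / (2 * √w) by positivity)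
    simpa using this
  have hL : AnalyticAt ℂ (besselL (|ν| + 1 / 2)) (1 / (2 * r w)) :=
    (differentiableOn_besselL ha).analyticAt (isOpen_wideSector.mem_nhds hmem)
  have hG : AnalyticAt ℂ (fun ζ => (k : ℂ) * r ζ ^ ((ν - 1 / 2 : ℝ) : ℂ) * Complex.exp (-r ζ)
      * besselL (|ν| + 1 / 2) (1 / (2 * r ζ))) w := by
    refine ((analyticAt_const.mul (hra.cpow analyticAt_const ?_)).mul hra.neg.cexp).mul
      (hL.comp_of_eq (analyticAt_const.div (analyticAt_const.mul hra) hr0) rfl)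
    rw [hrw w hw]; exact Complex.ofReal_mem_slitPlane.2 hsw
  refine hG.re_ofReal.congr ?_
  filter_upwards [lt_mem_nhds hw] with x hx
  have hsx := Real.sqrt_pos.2 hx
  have h := besselW_sq_eq_besselL ν hsx
  rw [Real.sq_sqrt hx.le] at h
  rw [← Complex.ofReal_re (besselW ν x), h, hrw x hx]
  congr 1
  rw [← Complex.ofReal_cpow hsx.le, hk]
  push_cast
  rfl

/-! ### Exponential decay and extension to sectors of opening larger than `π` -/

/-- The part of the open sector `|arg t| < 3π / 4` outside the disc of radius `R`. -/
def truncatedCone (R : ℝ) : Set ℂ := {t | -|t.im| < t.re ∧ R < ‖t‖}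

lemma isOpen_truncatedCone (R : ℝ) : IsOpen (truncatedCone R) :=
  (isOpen_lt (f := fun t : ℂ => -|t.im|) (g := Complex.re) (by fun_prop) (by fun_prop)).inter
    (isOpen_lt (f := fun _ : ℂ => R) (g := fun t => ‖t‖) (by fun_prop) (by fun_prop))

lemma truncatedCone_anti {R R' : ℝ} (h : R ≤ R') : truncatedCone R' ⊆ truncatedCone R :=
  fun _ ht => ⟨ht.1, h.trans_lt ht.2⟩

lemma ofReal_mem_truncatedCone {R x : ℝ} (hx : 0 < x) (h : R < x) : (x : ℂ) ∈ truncatedCone R := by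
  refine ⟨by simpa using hx, ?_⟩
  rwa [Complex.norm_real, Real.norm_of_nonneg hx.le]

/-- For large arguments, `f` is the restriction of a holomorphic function of polynomial growth on
a sector of opening `3π / 2`. Because this opening is larger than `π`, such an `f` cannot decay
exponentially without vanishing. -/
def HasConeExtension (f : ℝ → ℝ) : Prop :=
  ∃ (R C : ℝ) (N : ℕ) (F : ℂ → ℂ), 1 ≤ R ∧ 0 ≤ C ∧ DifferentiableOn ℂ F (truncatedCone R) ∧
    (∀ t ∈ truncatedCone R, ‖F t‖ ≤ C * ‖t‖ ^ N) ∧ ∀ x : ℝ, R < x → F x = f x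

namespace HasConeExtension

lemma zero : HasConeExtension fun _ => 0 :=
  ⟨1, 0, 0, fun _ => 0, le_rfl, le_rfl, by fun_prop, by simp, by simp⟩

lemma const_mul {f : ℝ → ℝ} (hf : HasConeExtension f) (c : ℝ) :
    HasConeExtension fun x => c * f x := by
  obtain ⟨R, C, N, F, hR, hC, hd, hb, he⟩ := hf
  refine ⟨R, |c| * C, N, fun t => c * F t, hR, by positivity, hd.const_mul _, fun t ht => ?_,
    fun x hx => by simp only [he x hx]; push_cast; rfl⟩
  rw [norm_mul, Complex.norm_real, Real.norm_eq_abs, mul_assoc]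
  exact mul_le_mul_of_nonneg_left (hb t ht) (abs_nonneg c)

lemma add {f g : ℝ → ℝ} (hf : HasConeExtension f) (hg : HasConeExtension g) :
    HasConeExtension fun x => f x + g x := by
  obtain ⟨R, C, N, F, hR, hC, hd, hb, he⟩ := hf
  obtain ⟨R', C', N', F', hR', hC', hd', hb', he'⟩ := hg
  have h1 := truncatedCone_anti (le_max_left R R')
  have h2 := truncatedCone_anti (le_max_right R R')
  refine ⟨max R R', C + C', max N N', fun t => F t + F' t, le_max_of_le_left hR, by positivity,
    (hd.mono h1).add (hd'.mono h2), fun t ht => ?_, fun x hx => ?_⟩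
  · have ht1 : 1 ≤ ‖t‖ := (le_max_of_le_left hR).trans ht.2.le
    calc ‖F t + F' t‖ ≤ C * ‖t‖ ^ N + C' * ‖t‖ ^ N' :=
          (norm_add_le _ _).trans (add_le_add (hb t (h1 ht)) (hb' t (h2 ht)))
      _ ≤ C * ‖t‖ ^ max N N' + C' * ‖t‖ ^ max N N' := by
          gcongr <;> first | assumption | simp
      _ = _ := by ring
  · simp only [he x ((le_max_left _ _).trans_lt hx), he' x ((le_max_right _ _).trans_lt hx)]
    push_cast; rfl

lemma sum {ι : Type*} (s : Finset ι) {f : ι → ℝ → ℝ} (hf : ∀ i ∈ s, HasConeExtension (f i)) :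
    HasConeExtension fun x => ∑ i ∈ s, f i x := by
  classical
  induction s using Finset.induction_on with
  | empty => simpa using zero
  | insert i s hi ih =>
    simp_rw [Finset.sum_insert hi]
    exact (hf i (Finset.mem_insert_self i s)).add
      (ih fun j hj => hf j (Finset.mem_insert_of_mem hj))

lemma isBigO_exp {f : ℝ → ℝ} (hf : HasConeExtension f) {ε : ℝ} (hε : 0 < ε) :
    f =O[atTop] fun x => Real.exp (ε * x) := by
  obtain ⟨R, C, N, F, hR, hC, hd, hb, he⟩ := hf
  have h1 : f =O[atTop] fun x : ℝ => x ^ N := by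
    refine Asymptotics.IsBigO.of_bound C ?_
    filter_upwards [eventually_gt_atTop R] with x hx
    have hx0 : 0 < x := by linarith
    have := hb x (ofReal_mem_truncatedCone hx0 hx)
    rwa [he x hx, Complex.norm_real, Complex.norm_real, ← norm_pow] at this
  exact h1.trans (isLittleO_pow_exp_pos_mul_atTop N hε).isBigO

end HasConeExtension

/-- The cube of a point of the quarter plane `|arg v| < π / 4` lies in the sector
`|arg t| < 3π / 4`. -/
lemma cube_mem_cone {v : ℂ} (hv : |v.im| < v.re) : -|(v ^ 3).im| < (v ^ 3).re := by
  have h1 : (v ^ 3).re = v.re ^ 3 - 3 * v.re * v.im ^ 2 := by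
    simp [pow_succ]; ring
  have h2 : (v ^ 3).im = v.im * (3 * v.re ^ 2 - v.im ^ 2) := by
    simp [pow_succ]; ring
  have hb := abs_nonneg v.im
  have h4 : 0 ≤ 3 * v.re ^ 2 - v.im ^ 2 := by rw [← sq_abs v.im]; nlinarith
  rw [h1, h2, abs_mul, abs_of_nonneg h4, ← sq_abs v.im]
  have h5 : 0 < (v.re - |v.im|) * (v.re ^ 2 + 4 * v.re * |v.im| + |v.im| ^ 2) := by
    have : 0 < v.re := by linarith
    have : 0 < v.re - |v.im| := by linarith
    positivity
  nlinarith

lemma abs_im_lt_re_sqrt {u : ℂ} (hu : 0 < u.re) :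
    |(u ^ ((1 / 2 : ℝ) : ℂ)).im| < (u ^ ((1 / 2 : ℝ) : ℂ)).re := by
  set v := u ^ ((1 / 2 : ℝ) : ℂ) with hv
  have hu0 : u ≠ 0 := fun h => by simp [h] at hu
  have hv2 : v ^ 2 = u := by
    rw [hv, ← Complex.cpow_nat_mul]; norm_num
  have hre : 0 ≤ v.re := by
    have harg := Complex.abs_arg_le_pi_div_two_iff.2 hu.le
    rw [abs_le] at harg
    have := Real.pi_pos
    rw [hv, Complex.cpow_def_of_ne_zero hu0, Complex.exp_re]
    refine mul_nonneg (Real.exp_pos _).le (Real.cos_nonneg_of_mem_Icc ?_)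
    rw [Complex.im_mul_ofReal, Complex.log_im]
    constructor <;> linarith
  have h1 : 0 < v.re ^ 2 - v.im ^ 2 := by
    rw [← hv2] at hu
    simpa [pow_two] using hu
  exact abs_lt_of_sq_lt_sq (by linarith) hre

/-- A function with a holomorphic extension of polynomial growth to a sector of opening larger
than `π` vanishes if it decays exponentially: the substitution `t = u ^ (3 / 2)` maps a half-plane
into the sector and makes the decay superexponential, so that the Phragmén–Lindelöf principle
applies. -/
theorem HasConeExtension.eventually_eq_zero {f : ℝ → ℝ} (hf : HasConeExtension f) {ε : ℝ}
    (hε : 0 < ε) (hdec : f =O[atTop] fun x => Real.exp (-ε * x)) : ∀ᶠ x in atTop, f x = 0 := by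
  obtain ⟨R, C, N, F, hR, hC, hd, hb, he⟩ := hf
  obtain ⟨K, hK⟩ := hdec.bound
  -- the shift by `R + 1` keeps `T ζ` outside the disc of radius `R` for all `ζ` with `Re ζ > -1`
  set u : ℂ → ℂ := fun ζ => ζ + ((R + 1 : ℝ) : ℂ) with hu
  set T : ℂ → ℂ := fun ζ => (u ζ ^ ((1 / 2 : ℝ) : ℂ)) ^ 3 with hT
  set h : ℂ → ℂ := fun ζ => F (T ζ) / T ζ ^ N with hh
  have hure : ∀ ζ : ℂ, -1 < ζ.re → R < (u ζ).re := fun ζ hζ => by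
    simp only [hu, Complex.add_re, Complex.ofReal_re]; linarith
  have hTnorm : ∀ ζ : ℂ, -1 < ζ.re → R < ‖T ζ‖ := fun ζ hζ => by
    have h1 : R < ‖u ζ‖ := (hure ζ hζ).trans_le (Complex.re_le_norm _)
    have h2 : ‖T ζ‖ = ‖u ζ‖ * √‖u ζ‖ := by
      rw [hT, norm_pow, Complex.norm_cpow_real, ← Real.sqrt_eq_rpow, pow_succ,
        Real.sq_sqrt (norm_nonneg _)]
    have h3 : 1 ≤ √‖u ζ‖ := Real.one_le_sqrt.2 (by linarith)
    rw [h2]; nlinarith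
  have hTmem : ∀ ζ : ℂ, -1 < ζ.re → T ζ ∈ truncatedCone R := fun ζ hζ =>
    ⟨cube_mem_cone (abs_im_lt_re_sqrt (by linarith [hure ζ hζ])), hTnorm ζ hζ⟩
  have hT0 : ∀ ζ : ℂ, -1 < ζ.re → T ζ ≠ 0 := fun ζ hζ h0 => by
    have := hTnorm ζ hζ
    rw [h0, norm_zero] at this; linarith
  have hTd : ∀ ζ : ℂ, -1 < ζ.re → DifferentiableAt ℂ T ζ := fun ζ hζ => by
    refine DifferentiableAt.pow (DifferentiableAt.cpow (by fun_prop) (by fun_prop) ?_) 3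
    exact Complex.mem_slitPlane_iff.2 (Or.inl (by linarith [hure ζ hζ]))
  have hhd : ∀ ζ : ℂ, -1 < ζ.re → DifferentiableAt ℂ h ζ := fun ζ hζ => by
    have h1 : DifferentiableAt ℂ F (T ζ) :=
      hd.differentiableAt ((isOpen_truncatedCone R).mem_nhds (hTmem ζ hζ))
    exact (h1.comp ζ (hTd ζ hζ)).div ((hTd ζ hζ).pow N) (pow_ne_zero _ (hT0 ζ hζ))
  have hhb : ∀ ζ : ℂ, -1 < ζ.re → ‖h ζ‖ ≤ C := fun ζ hζ => by
    have h1 : 0 < ‖T ζ‖ := norm_pos_iff.2 (hT0 ζ hζ)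
    simp only [hh]
    rw [norm_div, norm_pow, div_le_iff₀ (by positivity)]
    exact hb _ (hTmem ζ hζ)
  have hTreal : ∀ x : ℝ, 0 ≤ x → T x = (((x + R + 1) * √(x + R + 1) : ℝ) : ℂ) := fun x hx => by
    have h0 : 0 ≤ x + R + 1 := by linarith
    have h1 : u x = ((x + R + 1 : ℝ) : ℂ) := by simp only [hu]; push_cast; ring
    have h2 : √(x + R + 1) ^ 3 = (x + R + 1) * √(x + R + 1) := by
      rw [pow_succ, Real.sq_sqrt h0]
    simp only [hT]
    rw [h1, ← Complex.ofReal_cpow h0, ← Real.sqrt_eq_rpow, ← Complex.ofReal_pow, h2]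
  have hTR : ∀ x : ℝ, 0 ≤ x → R < (x + R + 1) * √(x + R + 1) := fun x hx => by
    have h3 : 1 ≤ √(x + R + 1) := Real.one_le_sqrt.2 (by linarith)
    nlinarith
  have hzero : EqOn h 0 {z : ℂ | 0 ≤ z.re} := by
    refine PhragmenLindelof.eq_zero_on_right_half_plane_of_superexponential_decay ?_ ?_ ?_ ?_
    · refine DifferentiableOn.diffContOnCl fun ζ hζ => (hhd ζ ?_).differentiableWithinAt
      rw [Complex.closure_setOfPred_lt_re] at hζ
      have hζ : 0 ≤ ζ.re := hζ
      linarith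
    · refine ⟨1, by norm_num, 0, Asymptotics.IsBigO.of_bound C ?_⟩
      refine eventually_inf_principal.2 (Eventually.of_forall fun ζ hζ => ?_)
      have hζ : 0 < ζ.re := hζ
      simpa using hhb ζ (by linarith)
    · intro n
      have hlim : Tendsto (fun x : ℝ => |K| * Real.exp (-x)) atTop (𝓝 0) := by
        simpa using (Real.tendsto_exp_neg_atTop_nhds_zero).const_mul |K|
      refine squeeze_zero' (Eventually.of_forall fun x => by positivity) ?_ hlim
      have hbig : Tendsto (fun x : ℝ => (x + R + 1) * √(x + R + 1)) atTop atTop := by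
        refine tendsto_atTop_mono' _ ?_ tendsto_id
        filter_upwards [eventually_ge_atTop 0] with x hx
        have h3 : 1 ≤ √(x + R + 1) := Real.one_le_sqrt.2 (by linarith)
        simp only [id]; nlinarith
      filter_upwards [hbig.eventually hK, eventually_ge_atTop 0,
        eventually_ge_atTop (((n + 1) / ε) ^ 2)] with x hx hx0 hxn
      have hR1 := hTR x hx0
      have hh1 : ‖h x‖ ≤ |K| * Real.exp (-ε * ((x + R + 1) * √(x + R + 1))) := by
        simp only [hh]
        rw [hTreal x hx0, he _ hR1, norm_div, norm_pow, Complex.norm_real, Complex.norm_real]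
        refine (div_le_self (norm_nonneg _) (one_le_pow₀ ?_)).trans (hx.trans ?_)
        · rw [Real.norm_of_nonneg (by linarith)]; linarith
        · rw [Real.norm_of_nonneg (Real.exp_pos _).le]
          exact mul_le_mul_of_nonneg_right (le_abs_self K) (Real.exp_pos _).le
      -- `u ^ (3 / 2)` eventually exceeds every multiple of `u`
      have hsq : (n + 1) ≤ ε * √(x + R + 1) := by
        have : (n + 1) / ε ≤ √(x + R + 1) := Real.le_sqrt_of_sq_le (by linarith)
        rwa [div_le_iff₀' hε] at this
      calc Real.exp x ^ n * ‖h x‖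
          ≤ Real.exp x ^ n * (|K| * Real.exp (-ε * ((x + R + 1) * √(x + R + 1)))) := by gcongr
        _ = |K| * Real.exp (n * x + -ε * ((x + R + 1) * √(x + R + 1))) := by
            rw [Real.exp_add, Real.exp_nat_mul]; ring
        _ ≤ |K| * Real.exp (-x) := by
            refine mul_le_mul_of_nonneg_left (Real.exp_le_exp.2 ?_) (abs_nonneg K)
            have hn : (0 : ℝ) ≤ n := n.cast_nonneg
            nlinarith [mul_le_mul_of_nonneg_left hsq (show 0 ≤ x + R + 1 by linarith)]
    · exact ⟨C, fun x => hhb _ (by simp)⟩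
  filter_upwards [eventually_ge_atTop (((R + 1) * √(R + 1)))] with y hy
  have hR0 : 0 ≤ R + 1 := by linarith
  have hy0 : 0 ≤ y := le_trans (by positivity) hy
  -- the point of the half-plane that is mapped to `y`
  set r : ℝ := y ^ (1 / 3 : ℝ) with hr
  have hr0 : 0 ≤ r := by positivity
  have hr3 : r ^ 3 = y := by
    rw [hr, ← Real.rpow_natCast, ← Real.rpow_mul hy0]; norm_num
  have hrR : √(R + 1) ≤ r := by
    refine le_of_pow_le_pow_left₀ (n := 3) (by norm_num) hr0 ?_
    rw [hr3, pow_succ, Real.sq_sqrt hR0]; exact hy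
  have hx0 : 0 ≤ r ^ 2 - (R + 1) := by
    have := Real.sqrt_le_left hr0 |>.1 hrR
    linarith
  have hval : (r ^ 2 - (R + 1) + R + 1) * √(r ^ 2 - (R + 1) + R + 1) = y := by
    rw [show r ^ 2 - (R + 1) + R + 1 = r ^ 2 by ring, Real.sqrt_sq hr0, ← hr3]; ring
  have h1 := hzero (show ((r ^ 2 - (R + 1) : ℝ) : ℂ) ∈ {z : ℂ | 0 ≤ z.re} by
    rwa [mem_ofPred_eq, Complex.ofReal_re])
  have h2 := hTR _ hx0
  simp only [hh, Pi.zero_apply] at h1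
  rw [hTreal _ hx0, hval] at h1
  rw [hval] at h2
  rw [he y h2] at h1
  have hy1 : y ≠ 0 := by linarith
  rcases div_eq_zero_iff.1 h1 with h3 | h3
  · exact_mod_cast h3
  · exact absurd h3 (pow_ne_zero _ (by exact_mod_cast hy1))

/-! ### Extension of one-dimensional sections to a sector -/

lemma norm_sqrt_sub_one_le {w : ℂ} (hw : 0 < w.re) :
    ‖w ^ ((1 / 2 : ℝ) : ℂ) - 1‖ ≤ ‖w - 1‖ := by
  set v := w ^ ((1 / 2 : ℝ) : ℂ) with hv
  have hv2 : v ^ 2 = w := by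
    rw [hv, ← Complex.cpow_nat_mul]; norm_num
  have hre : 0 < v.re := (abs_nonneg _).trans_lt (abs_im_lt_re_sqrt hw)
  have h1 : 1 ≤ ‖v + 1‖ := by
    refine le_trans ?_ (Complex.re_le_norm _)
    simp only [Complex.add_re, Complex.one_re]; linarith
  rw [← hv2, show v ^ 2 - 1 = (v - 1) * (v + 1) by ring, norm_mul]
  exact le_mul_of_one_le_right (norm_nonneg _) h1

/-- Small relative perturbations of points of the sector `|arg t| < 3π / 4` stay in
`wideSector`. -/
lemma mem_wideSector_of_norm_sub_le {w z : ℂ} (hw : -|w.im| < w.re) (h : ‖z - w‖ ≤ ‖w‖ / 10) :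
    z ∈ wideSector := by
  have h1 : |z.re - w.re| ≤ ‖w‖ / 10 := by
    rw [← Complex.sub_re]; exact (Complex.abs_re_le_norm _).trans h
  have h2 : |z.im - w.im| ≤ ‖w‖ / 10 := by
    rw [← Complex.sub_im]; exact (Complex.abs_im_le_norm _).trans h
  have h3 : |w.im| - ‖w‖ / 10 ≤ |z.im| := by
    have := abs_sub_abs_le_abs_sub w.im z.im
    rw [abs_sub_comm w.im] at this; linarith
  have h4 := (abs_le.1 h1).1
  have h5 := Complex.norm_le_abs_re_add_abs_im w
  have h6 := abs_nonneg w.im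
  have h0 : w ≠ 0 := fun h0 => by simp [h0] at hw
  have h7 := norm_pos_iff.2 h0
  simp only [wideSector, mem_ofPred_eq]
  rcases abs_cases w.re with ⟨h8, h9⟩ | ⟨h8, h9⟩ <;> linarith

/-- The Bessel factor of a one-dimensional section of a generalized hyperbolic density, freed of
its exponential decay `exp (-α * x)`, extends to a sector of opening larger than `π`. -/
theorem hasConeExtension_besselW (ν : ℝ) {α B : ℝ} (hα : 0 < α) (m : ℝ) (hB : 0 < B) :
    HasConeExtension fun x => Real.exp (α * x) * besselW ν (α ^ 2 * (x - m) ^ 2 + B) := by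
  have ha : 0 < |ν| + 1 / 2 := by positivity
  set a : ℝ := |ν| + 1 / 2 with had
  set e : ℝ := ν - 1 / 2 with he
  set k : ℝ := √(Real.pi / 2) / Real.Gamma a with hk
  -- the constant in `|W t - 1| ≤ C₁ / |t|`, which also bounds `|z t - α t| / α`
  set C₁ : ℝ := (2 * |m| * α ^ 2 + (α ^ 2 * m ^ 2 + B)) / α ^ 2 with hC₁
  have hC₁0 : 0 ≤ C₁ := by positivity
  set R : ℝ := max 1 (max (10 * C₁) (1 / α)) with hR
  have hR1 : 1 ≤ R := le_max_left _ _
  have hR2 : 10 * C₁ ≤ R := (le_max_left _ _).trans (le_max_right _ _)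
  have hR3 : 1 / α ≤ R := (le_max_right _ _).trans (le_max_right _ _)
  obtain ⟨CL, hCL0, hCL⟩ := norm_besselL_le ha (le_refl (5 / 2 : ℝ))
  -- `z = α t E` continues the square root of `Q`, where `E`, the square root of `W = Q / (α t)²`,
  -- is close to `1` for `|t| > R`
  set Q : ℂ → ℂ := fun t => (α : ℂ) ^ 2 * (t - m) ^ 2 + B with hQ
  set W : ℂ → ℂ := fun t => Q t / ((α : ℂ) * t) ^ 2 with hW
  set E : ℂ → ℂ := fun t => W t ^ ((1 / 2 : ℝ) : ℂ) with hE
  set z : ℂ → ℂ := fun t => (α : ℂ) * t * E t with hz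
  have hαC : (α : ℂ) ≠ 0 := by exact_mod_cast hα.ne'
  have ht0 : ∀ t ∈ truncatedCone R, t ≠ 0 := fun t ht h0 => by
    have := ht.2; rw [h0, norm_zero] at this; linarith
  have hWb : ∀ t ∈ truncatedCone R, ‖W t - 1‖ ≤ C₁ / ‖t‖ := fun t ht => by
    have h1 : 1 ≤ ‖t‖ := hR1.trans ht.2.le
    have h2 : W t - 1
        = (((-(2 * m * α ^ 2) : ℝ) : ℂ) * t + ((α ^ 2 * m ^ 2 + B : ℝ) : ℂ))
          / ((α : ℂ) * t) ^ 2 := by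
      have := ht0 t ht
      simp only [hW, hQ]; push_cast; field_simp; ring
    have h3 : ‖((-(2 * m * α ^ 2) : ℝ) : ℂ) * t + ((α ^ 2 * m ^ 2 + B : ℝ) : ℂ)‖
        ≤ (2 * |m| * α ^ 2 + (α ^ 2 * m ^ 2 + B)) * ‖t‖ := by
      refine (norm_add_le _ _).trans ?_
      have h4 : ‖((-(2 * m * α ^ 2) : ℝ) : ℂ)‖ = 2 * |m| * α ^ 2 := by
        rw [Complex.norm_real, Real.norm_eq_abs, abs_neg, abs_mul, abs_mul, abs_two,
          abs_of_pos (show 0 < α ^ 2 by positivity)]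
      have h5 : ‖((α ^ 2 * m ^ 2 + B : ℝ) : ℂ)‖ = α ^ 2 * m ^ 2 + B := by
        rw [Complex.norm_real, Real.norm_of_nonneg (by positivity)]
      rw [norm_mul, h4, h5, add_mul]
      gcongr
      exact le_mul_of_one_le_right (by positivity) h1
    rw [h2, norm_div, norm_pow, norm_mul, Complex.norm_real, Real.norm_of_nonneg hα.le, hC₁,
      div_div, div_le_div_iff₀ (by positivity) (by positivity)]
    calc _ ≤ (2 * |m| * α ^ 2 + (α ^ 2 * m ^ 2 + B)) * ‖t‖ * (α ^ 2 * ‖t‖) := by gcongr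
      _ = _ := by ring
  have hWb' : ∀ t ∈ truncatedCone R, ‖W t - 1‖ ≤ 1 / 10 := fun t ht => by
    have h1 : 0 < ‖t‖ := norm_pos_iff.2 (ht0 t ht)
    refine (hWb t ht).trans ?_
    rw [div_le_iff₀ h1]
    linarith [ht.2]
  have hWre : ∀ t ∈ truncatedCone R, 0 < (W t).re := fun t ht => by
    have h1 := (Complex.abs_re_le_norm _).trans (hWb' t ht)
    rw [Complex.sub_re, Complex.one_re] at h1
    linarith [(abs_le.1 h1).1]
  have hzsub : ∀ t, ‖z t - α * t‖ = α * ‖t‖ * ‖E t - 1‖ := fun t => by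
    simp only [hz]
    rw [show (α : ℂ) * t * E t - α * t = α * t * (E t - 1) by ring, norm_mul, norm_mul,
      Complex.norm_real, Real.norm_of_nonneg hα.le]
  have hzb1 : ∀ t ∈ truncatedCone R, ‖z t - α * t‖ ≤ α * C₁ := fun t ht => by
    have h1 : 0 < ‖t‖ := norm_pos_iff.2 (ht0 t ht)
    have h2 : ‖E t - 1‖ ≤ C₁ / ‖t‖ := (norm_sqrt_sub_one_le (hWre t ht)).trans (hWb t ht)
    rw [hzsub, mul_assoc]
    refine mul_le_mul_of_nonneg_left ?_ hα.le
    rwa [le_div_iff₀' h1] at h2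
  have hzb2 : ∀ t ∈ truncatedCone R, ‖z t - α * t‖ ≤ α * ‖t‖ / 10 := fun t ht => by
    have h2 : ‖E t - 1‖ ≤ 1 / 10 := (norm_sqrt_sub_one_le (hWre t ht)).trans (hWb' t ht)
    rw [hzsub]
    have : 0 ≤ α * ‖t‖ := by positivity
    nlinarith
  have hαt : ∀ t : ℂ, ‖(α : ℂ) * t‖ = α * ‖t‖ := fun t => by
    rw [norm_mul, Complex.norm_real, Real.norm_of_nonneg hα.le]
  have hzmem : ∀ t ∈ truncatedCone R, z t ∈ wideSector := fun t ht => by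
    refine mem_wideSector_of_norm_sub_le (w := α * t) ?_ (by rw [hαt]; exact hzb2 t ht)
    rw [Complex.re_ofReal_mul, Complex.im_ofReal_mul, abs_mul, abs_of_pos hα, ← mul_neg]
    exact mul_lt_mul_of_pos_left ht.1 hα
  have hzlow : ∀ t ∈ truncatedCone R, α * ‖t‖ / 2 ≤ ‖z t‖ := fun t ht => by
    have h1 := norm_sub_norm_le ((α : ℂ) * t) (z t)
    rw [norm_sub_rev, hαt] at h1
    have h2 : 0 ≤ α * ‖t‖ := by positivity
    linarith [hzb2 t ht]
  have hzup : ∀ t ∈ truncatedCone R, ‖z t‖ ≤ 2 * α * ‖t‖ := fun t ht => by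
    have h1 := norm_sub_norm_le (z t) ((α : ℂ) * t)
    rw [hαt] at h1
    have h2 : 0 ≤ α * ‖t‖ := by positivity
    linarith [hzb2 t ht]
  have hymem : ∀ t ∈ truncatedCone R, 1 / (2 * z t) ∈ wideSector := fun t ht => by
    have := real_mul_mem_wideSector (inv_mem_wideSector (hzmem t ht)) (one_half_pos (α := ℝ))
    convert! this using 1
    push_cast
    rw [one_div, mul_inv, one_div]
  refine ⟨R, |k| * (2 * α + 2 / α) ^ |e| * Real.exp (α * C₁) * CL, ⌈|e|⌉₊,
    fun t => (k : ℂ) * z t ^ (e : ℂ) * Complex.exp (α * t - z t) * besselL a (1 / (2 * z t)),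
    hR1, by positivity, ?_, ?_, ?_⟩
  · intro t ht
    refine DifferentiableAt.differentiableWithinAt ?_
    have h0 : ((α : ℂ) * t) ^ 2 ≠ 0 := pow_ne_zero _ (mul_ne_zero hαC (ht0 t ht))
    have hWd : DifferentiableAt ℂ W t :=
      DifferentiableAt.div (by fun_prop) (by fun_prop) h0
    have hEd : DifferentiableAt ℂ E t :=
      hWd.cpow (differentiableAt_const _) (Complex.mem_slitPlane_iff.2 (Or.inl (hWre t ht)))
    have hzd : DifferentiableAt ℂ z t := DifferentiableAt.mul (by fun_prop) hEd
    have hzs := wideSector_subset_slitPlane (hzmem t ht)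
    have hL : DifferentiableAt ℂ (besselL a) (1 / (2 * z t)) :=
      (differentiableOn_besselL ha).differentiableAt (isOpen_wideSector.mem_nhds (hymem t ht))
    have hyd : DifferentiableAt ℂ (fun t => 1 / (2 * z t)) t :=
      (differentiableAt_const _).div (hzd.const_mul 2)
        (mul_ne_zero two_ne_zero (Complex.slitPlane_ne_zero hzs))
    have hLd : DifferentiableAt ℂ (fun t => besselL a (1 / (2 * z t))) t :=
      DifferentiableAt.comp (g := besselL a) t hL hyd
    exact (((differentiableAt_const _).mul (hzd.cpow (differentiableAt_const _) hzs)).mul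
      (DifferentiableAt.cexp (by fun_prop))).mul hLd
  · intro t ht
    have h1 : 1 ≤ ‖t‖ := hR1.trans ht.2.le
    have hpow : ‖z t ^ (e : ℂ)‖ ≤ (2 * α + 2 / α) ^ |e| * ‖t‖ ^ ⌈|e|⌉₊ := by
      have hz0 : 0 < ‖z t‖ := lt_of_lt_of_le (by positivity) (hzlow t ht)
      rw [Complex.norm_cpow_real]
      refine (rpow_le_rpow_abs (X := (2 * α + 2 / α) * ‖t‖) hz0 ?_ ?_ e).trans ?_
      · refine (hzup t ht).trans ?_
        gcongr
        have : 0 < 2 / α := by positivity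
        linarith
      · calc ‖z t‖⁻¹ ≤ (α * ‖t‖ / 2)⁻¹ := inv_anti₀ (by positivity) (hzlow t ht)
          _ = 2 / α * ‖t‖⁻¹ := by field_simp
          _ ≤ (2 * α + 2 / α) * ‖t‖ := by
              gcongr
              · linarith
              · exact (inv_le_one_of_one_le₀ h1).trans h1
      · rw [Real.mul_rpow (by positivity) (norm_nonneg _)]
        refine mul_le_mul_of_nonneg_left ?_ (by positivity)
        rw [← Real.rpow_natCast]
        exact Real.rpow_le_rpow_of_exponent_le h1 (Nat.le_ceil _)
    have hexp : ‖Complex.exp (α * t - z t)‖ ≤ Real.exp (α * C₁) := by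
      refine (Complex.norm_exp_le_exp_norm _).trans (Real.exp_le_exp.2 ?_)
      rw [norm_sub_rev]; exact hzb1 t ht
    have hLb : ‖besselL a (1 / (2 * z t))‖ ≤ CL := by
      refine hCL _ (hymem t ht) ?_
      have h2 : 1 ≤ α * ‖t‖ := by
        have : 1 / α ≤ ‖t‖ := hR3.trans ht.2.le
        rwa [div_le_iff₀' hα] at this
      rw [norm_div, norm_mul, norm_one, Complex.norm_two]
      rw [div_le_iff₀ (by linarith [hzlow t ht])]
      linarith [hzlow t ht]
    rw [norm_mul, norm_mul, norm_mul, Complex.norm_real, Real.norm_eq_abs]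
    calc |k| * ‖z t ^ (e : ℂ)‖ * ‖Complex.exp (α * t - z t)‖ * ‖besselL a (1 / (2 * z t))‖
        ≤ |k| * ((2 * α + 2 / α) ^ |e| * ‖t‖ ^ ⌈|e|⌉₊) * Real.exp (α * C₁) * CL := by gcongr
      _ = _ := by ring
  · intro x hx
    have hx0 : 0 < x := by linarith
    have hq : 0 < α ^ 2 * (x - m) ^ 2 + B := by positivity
    have hs := Real.sqrt_pos.2 hq
    have hzx : z x = (√(α ^ 2 * (x - m) ^ 2 + B) : ℝ) := by
      have h1 : W x = (((α ^ 2 * (x - m) ^ 2 + B) / (α * x) ^ 2 : ℝ) : ℂ) := by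
        simp only [hW, hQ]; push_cast; rfl
      simp only [hz, hE]
      rw [h1, ← Complex.ofReal_cpow (by positivity), ← Real.sqrt_eq_rpow,
        Real.sqrt_div hq.le, Real.sqrt_sq (by positivity)]
      push_cast
      have : (x : ℂ) ≠ 0 := by exact_mod_cast hx0.ne'
      field_simp
    have h := besselW_sq_eq_besselL ν hs
    rw [Real.sq_sqrt hq.le] at h
    beta_reduce
    rw [Complex.ofReal_mul, h, hzx, ← Complex.ofReal_cpow hs.le, Complex.exp_sub]
    push_cast
    rw [Complex.exp_neg, hk, had, he]
    push_cast
    ring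

lemma analyticOnNhd_besselW_quadratic (ν : ℝ) {A B : ℝ} (hA : 0 < A) (m : ℝ) (hB : 0 < B) :
    AnalyticOnNhd ℝ (fun x => besselW ν (A * (x - m) ^ 2 + B)) univ := fun x _ => by
  refine AnalyticAt.comp_of_eq (analyticAt_besselW ν (w := A * (x - m) ^ 2 + B) (by positivity))
    ?_ rfl
  fun_prop

/-! ### Splitting a vanishing sum by rates of decay -/

lemma exists_pos_le_of_finset {ι : Type*} (s : Finset ι) {g : ι → ℝ} (hg : ∀ i ∈ s, 0 < g i) :
    ∃ ε > 0, ∀ i ∈ s, ε ≤ g i := by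
  have h : ∀ᶠ ε in 𝓝[>] (0 : ℝ), ∀ i ∈ s, ε ≤ g i :=
    (Finset.eventually_all s).2 fun i hi =>
      mem_nhdsWithin_of_mem_nhds (Iic_mem_nhds (hg i hi))
  obtain ⟨ε, h1, h2⟩ := (h.and self_mem_nhdsWithin).exists
  exact ⟨ε, h2, h1⟩

/-- A vanishing sum of terms `exp (-b i * x) * F i x`, in which the factors `F i` extend to a
sector of opening larger than `π` with polynomial growth, splits exactly into the partial sums
over the different rates `b i`. The partial sum of smallest rate is exponentially smaller than
its individual terms, hence zero. -/
theorem sum_filter_rate_eq_zero {ι : Type*} (b : ι → ℝ) (F : ι → ℝ → ℝ) (s : Finset ι)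
    (hF : ∀ i ∈ s, HasConeExtension (F i)) (hA : ∀ i ∈ s, AnalyticOnNhd ℝ (F i) univ)
    (h : ∀ x, ∑ i ∈ s, Real.exp (-b i * x) * F i x = 0) (β : ℝ) (x : ℝ) :
    ∑ i ∈ s with b i = β, Real.exp (-b i * x) * F i x = 0 := by
  classical
  induction s using Finset.strongInduction generalizing β x with
  | H s ih =>
    rcases s.eq_empty_or_nonempty with rfl | hs
    · simp
    obtain ⟨j, hj, hmin⟩ := s.exists_min_image b hs
    have hsplit : ∀ x, ∑ i ∈ s with b i = b j, Real.exp (-b i * x) * F i x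
        + ∑ i ∈ s with b i ≠ b j, Real.exp (-b i * x) * F i x = 0 := fun x => by
      rw [Finset.sum_filter_add_sum_filter_not]; exact h x
    have hgroup : ∀ x, ∑ i ∈ s with b i = b j, Real.exp (-b i * x) * F i x
        = Real.exp (-b j * x) * ∑ i ∈ s with b i = b j, F i x := fun x => by
      rw [Finset.mul_sum]
      refine Finset.sum_congr rfl fun i hi => ?_
      rw [(Finset.mem_filter.1 hi).2]
    have hext : HasConeExtension fun x => ∑ i ∈ s with b i = b j, F i x :=
      HasConeExtension.sum _ fun i hi => hF i (Finset.mem_filter.1 hi).1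
    obtain ⟨ε, hε, hgap⟩ := exists_pos_le_of_finset (s.filter fun i => b i ≠ b j)
      (g := fun i => (b i - b j) / 2) fun i hi => by
        have hi' := Finset.mem_filter.1 hi
        have := lt_of_le_of_ne (hmin i hi'.1) (Ne.symm hi'.2)
        linarith
    -- the sum of smallest rate equals minus the remaining terms, which decay faster by at least
    -- the factor `exp (-ε * x)`
    have hdec : (fun x => ∑ i ∈ s with b i = b j, F i x) =O[atTop] fun x => Real.exp (-ε * x) := by
      have h1 : ∀ x, ∑ i ∈ s with b i = b j, F i x
          = ∑ i ∈ s with b i ≠ b j, -(Real.exp (-(b i - b j) * x) * F i x) := fun x => by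
        have h2 := hsplit x
        rw [hgroup] at h2
        have h3 : ∀ i, Real.exp (-b i * x) = Real.exp (-b j * x) * Real.exp (-(b i - b j) * x) :=
          fun i => by rw [← Real.exp_add]; ring_nf
        have h4 : ∑ i ∈ s with b i ≠ b j, Real.exp (-b i * x) * F i x = Real.exp (-b j * x)
            * ∑ i ∈ s with b i ≠ b j, Real.exp (-(b i - b j) * x) * F i x := by
          rw [Finset.mul_sum]
          exact Finset.sum_congr rfl fun i _ => by rw [h3, mul_assoc]
        rw [h4, ← mul_add] at h2
        rw [Finset.sum_neg_distrib]
        exact eq_neg_of_add_eq_zero_left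
          ((mul_eq_zero.1 h2).resolve_left (Real.exp_pos _).ne')
      rw [funext h1]
      refine Asymptotics.IsBigO.fun_sum fun i hi => Asymptotics.IsBigO.neg_left ?_
      have h2 := (Asymptotics.isBigO_refl (fun x => Real.exp (-(b i - b j) * x)) atTop).mul
        ((hF i (Finset.mem_filter.1 hi).1).isBigO_exp hε)
      refine h2.trans (Asymptotics.IsBigO.of_bound 1 ?_)
      filter_upwards [eventually_ge_atTop 0] with x hx
      rw [← Real.exp_add, one_mul, Real.norm_of_nonneg (Real.exp_pos _).le,
        Real.norm_of_nonneg (Real.exp_pos _).le, Real.exp_le_exp]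
      nlinarith [hgap i hi]
    have hzero : ∀ x, ∑ i ∈ s with b i = b j, F i x = 0 := by
      have han : AnalyticOnNhd ℝ (fun x => ∑ i ∈ s with b i = b j, F i x) univ :=
        Finset.analyticOnNhd_fun_sum _ fun i hi => hA i (Finset.mem_filter.1 hi).1
      obtain ⟨X, hX⟩ := eventually_atTop.1 (hext.eventually_eq_zero hε hdec)
      have hev : (fun x => ∑ i ∈ s with b i = b j, F i x) =ᶠ[𝓝 (X + 1)] fun _ => 0 := by
        filter_upwards [lt_mem_nhds (lt_add_one X)] with x hx
        exact hX x hx.le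
      intro x
      exact han.eqOn_zero_of_preconnected_of_eventuallyEq_zero isPreconnected_univ
        (mem_univ (X + 1)) hev (mem_univ x)
    by_cases hβ : β = b j
    · rw [hβ, hgroup, hzero, mul_zero]
    · have hrest : ∀ x, ∑ i ∈ s with b i ≠ b j, Real.exp (-b i * x) * F i x = 0 := fun x => by
        have h2 := hsplit x
        rwa [hgroup, hzero, mul_zero, zero_add] at h2
      have hss : (s.filter fun i => b i ≠ b j) ⊂ s :=
        Finset.filter_ssubset.2 ⟨j, hj, by simp⟩
      have h3 := ih _ hss (fun i hi => hF i (Finset.mem_filter.1 hi).1)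
        (fun i hi => hA i (Finset.mem_filter.1 hi).1) hrest β x
      rw [Finset.filter_filter] at h3
      convert! h3 using 2
      ext i
      simp only [Finset.mem_filter]
      constructor
      · rintro ⟨h4, h5⟩
        exact ⟨h4, by rw [h5]; exact hβ, h5⟩
      · rintro ⟨h4, _, h5⟩
        exact ⟨h4, h5⟩

/-- Comparing the behaviour at `+∞` and at `-∞` separates the terms of a vanishing sum according to
the pair `(α, γ)`, which is determined by the two rates `α - γ` and `α + γ`. -/
theorem sum_filter_besselW_eq_zero {ι : Type*} (s : Finset ι) (c ν α γ m B : ι → ℝ)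
    (hα : ∀ i ∈ s, 0 < α i) (hB : ∀ i ∈ s, 0 < B i)
    (h : ∀ x, ∑ i ∈ s, c i * (Real.exp (γ i * x)
      * besselW (ν i) (α i ^ 2 * (x - m i) ^ 2 + B i)) = 0) (α₀ γ₀ x : ℝ) :
    ∑ i ∈ s with α i = α₀ ∧ γ i = γ₀, c i * besselW (ν i) (α₀ ^ 2 * (x - m i) ^ 2 + B i) = 0 := by
  classical
  have hext : ∀ m' : ι → ℝ, ∀ i ∈ s, HasConeExtension fun x =>
      c i * (Real.exp (α i * x) * besselW (ν i) (α i ^ 2 * (x - m' i) ^ 2 + B i)) :=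
    fun m' i hi => (hasConeExtension_besselW (ν i) (hα i hi) (m' i) (hB i hi)).const_mul (c i)
  have han : ∀ m' : ι → ℝ, ∀ i ∈ s, AnalyticOnNhd ℝ (fun x =>
      c i * (Real.exp (α i * x) * besselW (ν i) (α i ^ 2 * (x - m' i) ^ 2 + B i))) univ :=
    fun m' i hi => by
      have h1 := analyticOnNhd_besselW_quadratic (ν i) (pow_pos (hα i hi) 2) (m' i) (hB i hi)
      have h2 : AnalyticOnNhd ℝ (fun x => Real.exp (α i * x)) univ := fun x _ => by fun_prop
      exact analyticOnNhd_const.mul (h2.mul h1)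
  have hexp : ∀ (i : ι) (γ' x w : ℝ), Real.exp (-(α i - γ') * x)
      * (c i * (Real.exp (α i * x) * w)) = c i * (Real.exp (γ' * x) * w) := fun i γ' x w => by
    have : Real.exp (γ' * x) = Real.exp (-(α i - γ') * x) * Real.exp (α i * x) := by
      rw [← Real.exp_add]; ring_nf
    rw [this]; ring
  have h1 : ∀ x, ∑ i ∈ s with α i - γ i = α₀ - γ₀, c i * (Real.exp (γ i * x)
      * besselW (ν i) (α i ^ 2 * (x - m i) ^ 2 + B i)) = 0 := fun x => by
    have := sum_filter_rate_eq_zero (fun i => α i - γ i) _ s (hext m) (han m)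
      (fun x => by simp_rw [hexp]; exact h x) (α₀ - γ₀) x
    simpa only [hexp] using this
  -- the reflection `x ↦ -x` replaces `m` by `-m` and `γ` by `-γ`
  set s₁ := s.filter fun i => α i - γ i = α₀ - γ₀ with hs₁
  have hsub : ∀ i ∈ s₁, i ∈ s := fun i hi => (Finset.mem_filter.1 hi).1
  have hrefl : ∀ (i : ι) (x : ℝ), (-x - m i) ^ 2 = (x - -m i) ^ 2 := fun i x => by ring
  have h2 := sum_filter_rate_eq_zero (fun i => α i - -γ i) _ s₁
    (fun i hi => hext (fun i => -m i) i (hsub i hi)) (fun i hi => han (fun i => -m i) i (hsub i hi))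
    (fun x => by
      simp_rw [hexp]
      have := h1 (-x)
      simp_rw [hrefl, mul_neg, ← neg_mul] at this
      exact this) (α₀ + γ₀) (-x)
  simp only [hexp] at h2
  rw [hs₁, Finset.filter_filter] at h2
  have h3 : ∑ i ∈ s with α i = α₀ ∧ γ i = γ₀, Real.exp (γ₀ * x)
      * (c i * besselW (ν i) (α₀ ^ 2 * (x - m i) ^ 2 + B i)) = 0 := by
    rw [← h2]
    refine Finset.sum_congr ?_ fun i hi => ?_
    · ext i
      simp only [Finset.mem_filter]
      refine and_congr_right fun _ => ⟨fun ⟨h4, h5⟩ => ?_, fun ⟨h4, h5⟩ => ?_⟩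
      · rw [h4, h5]; exact ⟨rfl, by ring⟩
      · constructor <;> linarith
    · simp only [Finset.mem_filter] at hi
      have h4 : α i = α₀ := by linarith [hi.2.1, hi.2.2]
      have h5 : γ i = γ₀ := by linarith [hi.2.1, hi.2.2]
      rw [h4, h5, ← hrefl, neg_neg, neg_mul_neg]
      ring
  rw [← Finset.mul_sum] at h3
  exact (mul_eq_zero.1 h3).resolve_left (Real.exp_pos _).ne'

/-! ### Fourier transform of the Bessel factor -/

lemma integral_fourier_shifted_gaussian {b : ℝ} (hb : 0 < b) (ξ m : ℝ) :
    ∫ x : ℝ, Complex.exp (Complex.I * ξ * x) * (Real.exp (-b * (x - m) ^ 2) : ℂ)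
      = ((√(Real.pi / b) * Real.exp (-ξ ^ 2 / (4 * b)) : ℝ) : ℂ)
        * Complex.exp (Complex.I * ξ * m) := by
  have h := fourierIntegral_gaussian (b := b) (by simpa using hb) ξ
  rw [← integral_sub_right_eq_self _ m, ← Complex.ofReal_div,
    show (1 / 2 : ℂ) = ((1 / 2 : ℝ) : ℂ) by push_cast; rfl, ← Complex.ofReal_cpow (by positivity),
    ← Real.sqrt_eq_rpow] at h
  push_cast
  rw [← h, ← integral_mul_const]
  refine integral_congr_ae (ae_of_all _ fun x => ?_)
  simp only
  rw [← Complex.exp_add, ← Complex.exp_add, ← Complex.exp_add]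
  congr 1
  push_cast
  ring

lemma besselWKernel_quadratic (ν A m B x t : ℝ) :
    besselWKernel ν (A * (x - m) ^ 2 + B) t
      = besselWKernel ν B t * Real.exp (-(A / 2 * Real.exp (-t)) * (x - m) ^ 2) := by
  rw [add_comm, besselWKernel_add]; ring_nf

lemma integral_fourier_besselWKernel {A : ℝ} (hA : 0 < A) (ν ξ m B t : ℝ) :
    ∫ x : ℝ, Complex.exp (Complex.I * ξ * x) * (besselWKernel ν (A * (x - m) ^ 2 + B) t : ℂ)
      = ((√(2 * Real.pi / A) : ℝ) : ℂ) * Complex.exp (Complex.I * ξ * m)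
        * ((besselWKernel (ν + 1 / 2) B t * Real.exp (-(ξ ^ 2 / A) / 2 * Real.exp t) : ℝ) : ℂ) := by
  have h := integral_fourier_shifted_gaussian (b := A / 2 * Real.exp (-t)) (by positivity) ξ m
  simp_rw [besselWKernel_quadratic, Complex.ofReal_mul, mul_left_comm _ (besselWKernel ν B t : ℂ)]
  have h1 : Real.pi / (A / 2 * Real.exp (-t)) = 2 * Real.pi / A * Real.exp t := by
    rw [Real.exp_neg]; field_simp
  have h2 : √(Real.exp t) = Real.exp (t / 2) := Real.sqrt_eq_iff_mul_self_eq
    (Real.exp_pos _).le (Real.exp_pos _).le |>.2 (by rw [← Real.exp_add]; ring_nf)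
  have h3 : -ξ ^ 2 / (4 * (A / 2 * Real.exp (-t))) = -(ξ ^ 2 / A) / 2 * Real.exp t := by
    rw [Real.exp_neg]; field_simp; ring
  have h4 : besselWKernel (ν + 1 / 2) B t = besselWKernel ν B t * Real.exp (t / 2) := by
    rw [besselWKernel, besselWKernel, ← Real.exp_add]; ring_nf
  have hreal : besselWKernel ν B t * (√(Real.pi / (A / 2 * Real.exp (-t)))
      * Real.exp (-ξ ^ 2 / (4 * (A / 2 * Real.exp (-t)))))
      = √(2 * Real.pi / A)
        * (besselWKernel (ν + 1 / 2) B t * Real.exp (-(ξ ^ 2 / A) / 2 * Real.exp t)) := by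
    rw [h1, Real.sqrt_mul (by positivity), h2, h3, h4]
    ring
  rw [integral_const_mul, h, ← mul_assoc, ← Complex.ofReal_mul, hreal]
  push_cast
  ring

/-- The scaling behind the Fourier transform: `t ↦ t - log q`. -/
lemma integral_besselWKernel_mul_exp (κ : ℝ) {B q : ℝ} (hB : 0 < B) (hq : 0 < q) :
    ∫ t : ℝ, besselWKernel κ B t * Real.exp (-(q - 1) / 2 * Real.exp t)
      = 2 * q ^ (-κ) * besselW κ (B * q) := by
  rw [besselW_eq_integral κ (by positivity), ← integral_sub_right_eq_self _ (Real.log q),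
    ← mul_assoc, mul_one_div, mul_div_assoc, mul_comm 2, div_mul_cancel₀ _ two_ne_zero,
    ← integral_const_mul]
  refine integral_congr_ae (ae_of_all _ fun t => ?_)
  simp only [besselWKernel]
  rw [Real.rpow_def_of_pos hq, ← Real.exp_add, ← Real.exp_add, neg_sub, Real.exp_sub t,
    Real.exp_sub (Real.log q), Real.exp_log hq, Real.exp_neg]
  congr 1
  field_simp
  ring

lemma integrable_fourier_besselWKernel_prod {A B : ℝ} (hA : 0 < A) (hB : 0 < B) (ν ξ m : ℝ) :
    Integrable (Function.uncurry fun x t : ℝ => Complex.exp (Complex.I * ξ * x)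
      * (besselWKernel ν (A * (x - m) ^ 2 + B) t : ℂ)) (volume.prod volume) := by
  have hm : Measurable (Function.uncurry fun x t : ℝ => Complex.exp (Complex.I * ξ * x)
      * (besselWKernel ν (A * (x - m) ^ 2 + B) t : ℂ)) := by
    unfold besselWKernel Function.uncurry; fun_prop
  have hn : ∀ x t : ℝ, ‖Complex.exp (Complex.I * ξ * x)
      * (besselWKernel ν (A * (x - m) ^ 2 + B) t : ℂ)‖
        = besselWKernel ν (A * (x - m) ^ 2 + B) t := fun x t => by
    rw [norm_mul, Complex.norm_real, Real.norm_of_nonneg (besselWKernel_pos _ _ _).le,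
      show Complex.I * ξ * x = ((ξ * x : ℝ) : ℂ) * Complex.I by push_cast; ring,
      Complex.norm_exp_ofReal_mul_I, one_mul]
  have hi : ∀ t, Integrable fun x => besselWKernel ν (A * (x - m) ^ 2 + B) t := fun t => by
    simp_rw [besselWKernel_quadratic]
    exact ((integrable_exp_neg_mul_sq (b := A / 2 * Real.exp (-t))
      (by positivity)).comp_sub_right m).const_mul _
  refine (integrable_prod_iff' hm.aestronglyMeasurable).2 ⟨ae_of_all _ fun t => ?_, ?_⟩
  · refine (hi t).mono' (hm.comp (measurable_id.prodMk measurable_const)).aestronglyMeasurable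
      (ae_of_all _ fun x => (hn x t).le)
  · refine ((integrable_besselWKernel (ν + 1 / 2) hB).const_mul √(2 * Real.pi / A)).congr
      (ae_of_all _ fun t => ?_)
    simp only [Function.uncurry, hn]
    have h := integral_fourier_besselWKernel hA ν 0 m B t
    simp only [Complex.ofReal_zero, mul_zero, zero_mul, Complex.exp_zero, one_mul, mul_one] at h
    rw [integral_complex_ofReal, ← Complex.ofReal_mul] at h
    have h' := Complex.ofReal_injective h
    rw [h']
    simp

lemma integrable_fourier_besselW {A B : ℝ} (hA : 0 < A) (hB : 0 < B) (ν ξ m : ℝ) :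
    Integrable fun x : ℝ => Complex.exp (Complex.I * ξ * x)
      * (besselW ν (A * (x - m) ^ 2 + B) : ℂ) := by
  have h := ((integrable_fourier_besselWKernel_prod hA hB ν ξ m).integral_prod_left).const_mul
    (1 / 2 : ℂ)
  refine h.congr (ae_of_all _ fun x => ?_)
  simp only [Function.uncurry]
  rw [integral_const_mul, integral_complex_ofReal, besselW_eq_integral ν (by positivity)]
  push_cast
  ring

/-- The Fourier transform of the Bessel factor, again a Bessel factor: this is the characteristic
function of the symmetric generalized hyperbolic distribution on the line. -/
theorem integral_fourier_besselW {A B : ℝ} (hA : 0 < A) (hB : 0 < B) (ν ξ m : ℝ) :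
    ∫ x : ℝ, Complex.exp (Complex.I * ξ * x) * (besselW ν (A * (x - m) ^ 2 + B) : ℂ)
      = ((√(2 * Real.pi / A) : ℝ) : ℂ) * Complex.exp (Complex.I * ξ * m)
        * (((1 + ξ ^ 2 / A) ^ (-(ν + 1 / 2)) * besselW (ν + 1 / 2) (B * (1 + ξ ^ 2 / A)) : ℝ)
          : ℂ) := by
  have h := integral_integral_swap (integrable_fourier_besselWKernel_prod hA hB ν ξ m)
  have h1 : ∀ x : ℝ, Complex.exp (Complex.I * ξ * x) * (besselW ν (A * (x - m) ^ 2 + B) : ℂ)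
      = (1 / 2 : ℂ) * ∫ t, Complex.exp (Complex.I * ξ * x)
        * (besselWKernel ν (A * (x - m) ^ 2 + B) t : ℂ) := fun x => by
    rw [integral_const_mul, integral_complex_ofReal, besselW_eq_integral ν (by positivity)]
    push_cast
    ring
  simp_rw [h1]
  rw [integral_const_mul, h]
  simp_rw [integral_fourier_besselWKernel hA]
  have h2 := integral_besselWKernel_mul_exp (ν + 1 / 2) hB (show 0 < 1 + ξ ^ 2 / A by positivity)
  rw [add_sub_cancel_left] at h2
  rw [integral_const_mul, integral_complex_ofReal, h2]
  push_cast
  ring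

/-! ### Linear independence in dimension one -/

/-- A trigonometric sum with distinct frequencies that tends to zero at infinity has zero
coefficients. The operator `f ↦ f (· + h) - exp (I * h * m k) * f` removes the frequency `m k` and
multiplies the coefficient of the frequency `m j` by a nonzero number if `h` is suitably chosen. -/
theorem eq_zero_of_tendsto_trigonometric_sum {ι : Type*} (m : ι → ℝ) (s : Finset ι)
    (hm : InjOn m s) (c : ι → ℂ)
    (h : Tendsto (fun ξ : ℝ => ∑ i ∈ s, c i * Complex.exp (Complex.I * ξ * m i)) atTop (𝓝 0)) :
    ∀ i ∈ s, c i = 0 := by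
  classical
  induction s using Finset.induction_on generalizing c with
  | empty => simp
  | insert k s hk ih =>
    have hs : ∀ j ∈ s, c j = 0 := fun j hj => by
      have hjk : m j - m k ≠ 0 := sub_ne_zero.2 fun h1 => hk <| by
        have := hm (Finset.mem_coe.2 (Finset.mem_insert_of_mem hj))
          (Finset.mem_coe.2 (Finset.mem_insert_self k s)) h1
        rwa [← this]
      -- with this shift the ratio of the exponentials of the frequencies `m j` and `m k` is `-1`
      set δ : ℝ := Real.pi / (m j - m k) with hδ
      have h1 := (h.comp (tendsto_atTop_add_const_right atTop δ tendsto_id)).sub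
        (h.const_mul (Complex.exp (Complex.I * δ * m k)))
      rw [mul_zero, sub_zero] at h1
      have h2 := ih (hm.mono (Finset.coe_subset.2 (Finset.subset_insert k s)))
        (fun i => c i * (Complex.exp (Complex.I * δ * m i) - Complex.exp (Complex.I * δ * m k)))
        (h1.congr fun ξ => ?_) j hj
      · refine (mul_eq_zero.1 h2).resolve_right fun h3 => ?_
        have h4 : Complex.exp (Complex.I * δ * m j)
            = Complex.exp (Real.pi * Complex.I) * Complex.exp (Complex.I * δ * m k) := by
          rw [← Complex.exp_add]
          congr 1
          have h5 : (δ : ℂ) * m j = Real.pi + δ * m k := by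
            rw [← Complex.ofReal_mul, ← Complex.ofReal_mul, ← Complex.ofReal_add]
            congr 1
            rw [hδ]; field_simp; ring
          linear_combination Complex.I * h5
        rw [h4, Complex.exp_pi_mul_I] at h3
        have h6 := Complex.exp_ne_zero (Complex.I * δ * m k)
        apply h6
        linear_combination (-1 / 2 : ℂ) * h3
      · have h7 : ∀ i, Complex.exp (Complex.I * ((ξ + δ : ℝ) : ℂ) * m i)
            = Complex.exp (Complex.I * ξ * m i) * Complex.exp (Complex.I * δ * m i) := fun i => by
          rw [← Complex.exp_add]; push_cast; ring_nf
        simp only [Function.comp, id, Finset.sum_insert hk, h7]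
        rw [mul_add, Finset.mul_sum, add_sub_add_comm, ← Finset.sum_sub_distrib]
        rw [show ∀ a b d : ℂ, a * (b * d) - d * (a * b) = 0 from fun a b d => by ring, zero_add]
        exact Finset.sum_congr rfl fun i _ => by ring
    have hck : c k = 0 := by
      have h1 : ∀ ξ : ℝ, ‖∑ i ∈ insert k s, c i * Complex.exp (Complex.I * ξ * m i)‖ = ‖c k‖ :=
        fun ξ => by
          rw [Finset.sum_insert hk, Finset.sum_eq_zero (fun i hi => by rw [hs i hi, zero_mul]),
            add_zero, norm_mul, show Complex.I * ξ * m k = ((ξ * m k : ℝ) : ℂ) * Complex.I by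
              push_cast; ring, Complex.norm_exp_ofReal_mul_I, mul_one]
      have h2 := h.norm
      simp_rw [h1, norm_zero] at h2
      exact norm_eq_zero.1 (tendsto_nhds_unique tendsto_const_nhds h2)
    intro i hi
    rcases Finset.mem_insert.1 hi with rfl | hi
    · exact hck
    · exact hs i hi

lemma tendsto_normalized_besselW (κ κ₀ : ℝ) {B B₀ : ℝ} (hB : 0 < B)
    (h : B₀ < B ∨ B₀ = B ∧ κ₀ ≤ κ) :
    Tendsto (fun r : ℝ => (r ^ 2) ^ (-κ) * besselW κ (B * r ^ 2)
        * (r ^ (κ₀ + 1 / 2) * Real.exp (√B₀ * r))) atTop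
      (𝓝 (if B = B₀ ∧ κ = κ₀ then √(Real.pi / 2) * √B ^ (κ - 1 / 2) else 0)) := by
  have hs := Real.sqrt_pos.2 hB
  have h1 := (tendsto_besselW_sq κ).comp (tendsto_id.const_mul_atTop hs)
  have h2 : Tendsto (fun r : ℝ => r ^ (κ₀ - κ) * Real.exp (-(√B - √B₀) * r)) atTop
      (𝓝 (if B = B₀ ∧ κ = κ₀ then 1 else 0)) := by
    rcases h with h | ⟨rfl, h⟩
    · rw [if_neg fun h' => h.ne' h'.1]
      exact tendsto_rpow_mul_exp_neg_mul_atTop_nhds_zero _ _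
        (sub_pos.2 (Real.sqrt_lt_sqrt_iff_of_pos hB |>.2 h))
    · simp only [sub_self, neg_zero, zero_mul, Real.exp_zero, mul_one, true_and]
      rcases h.eq_or_lt with rfl | h
      · simp
      · rw [if_neg h.ne']
        simpa using tendsto_rpow_neg_atTop (sub_pos.2 h)
  have h3 := (h1.mul_const (√B ^ (κ - 1 / 2))).mul h2
  rw [mul_ite, mul_one, mul_zero] at h3
  refine h3.congr' ?_
  filter_upwards [eventually_gt_atTop 0] with r hr
  have e1 : (√B * r) ^ 2 = B * r ^ 2 := by rw [mul_pow, Real.sq_sqrt hB.le]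
  have e2 : Real.exp (√B₀ * r) = Real.exp (√B * r) * Real.exp (-(√B - √B₀) * r) := by
    rw [← Real.exp_add]; ring_nf
  have e3 : √B ^ (1 / 2 - κ) * √B ^ (κ - 1 / 2) = 1 := by
    rw [← Real.rpow_add hs]; norm_num
  have e4 : (r ^ 2) ^ (-κ) * r ^ (κ₀ + 1 / 2) = r ^ (1 / 2 - κ) * r ^ (κ₀ - κ) := by
    rw [← Real.rpow_natCast r 2, ← Real.rpow_mul hr.le, ← Real.rpow_add hr, ← Real.rpow_add hr]
    congr 1
    push_cast
    ring
  simp only [Function.comp, id]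
  rw [e1, e2, Real.mul_rpow hs.le hr.le]
  linear_combination (besselW κ (B * r ^ 2) * Real.exp (√B * r) * Real.exp (-(√B - √B₀) * r))
    * (r ^ (1 / 2 - κ) * r ^ (κ₀ - κ) * e3 - e4)

/-- Linear independence of the Bessel factors with a common scale. By Fourier transformation the
location parameters become frequencies, and the decay of the transform at infinity identifies `B`
and `ν`. -/
theorem eq_zero_of_sum_besselW_eq_zero {ι : Type*} (s : Finset ι) (c ν m B : ι → ℝ) {A : ℝ}
    (hA : 0 < A) (hB : ∀ i ∈ s, 0 < B i) (hinj : InjOn (fun i => (ν i, m i, B i)) s)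
    (h : ∀ x, ∑ i ∈ s, c i * besselW (ν i) (A * (x - m i) ^ 2 + B i) = 0) :
    ∀ i ∈ s, c i = 0 := by
  classical
  have hF : ∀ ξ : ℝ, ∑ i ∈ s, (c i : ℂ) * Complex.exp (Complex.I * ξ * m i)
      * (((1 + ξ ^ 2 / A) ^ (-(ν i + 1 / 2)) * besselW (ν i + 1 / 2) (B i * (1 + ξ ^ 2 / A)) : ℝ)
        : ℂ) = 0 := fun ξ => by
    have h1 : ∫ x : ℝ, ∑ i ∈ s, (c i : ℂ) * (Complex.exp (Complex.I * ξ * x)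
        * (besselW (ν i) (A * (x - m i) ^ 2 + B i) : ℂ)) = 0 := by
      rw [← integral_zero ℝ ℂ]
      refine integral_congr_ae (ae_of_all _ fun x => ?_)
      have h2 := congrArg Complex.ofReal (h x)
      push_cast at h2
      simp only
      rw [← mul_zero (Complex.exp (Complex.I * ξ * x)), ← h2, Finset.mul_sum]
      exact Finset.sum_congr rfl fun i _ => by ring
    rw [integral_finsetSum _ fun i hi =>
      (integrable_fourier_besselW hA (hB i hi) (ν i) ξ (m i)).const_mul _] at h1
    have h3 : ((√(2 * Real.pi / A) : ℝ) : ℂ) ≠ 0 := by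
      exact_mod_cast (Real.sqrt_pos.2 (show 0 < 2 * Real.pi / A by positivity)).ne'
    refine (mul_eq_zero.1 (?_ : ((√(2 * Real.pi / A) : ℝ) : ℂ) * _ = 0)).resolve_left h3
    rw [← h1, Finset.mul_sum]
    refine Finset.sum_congr rfl fun i hi => ?_
    rw [integral_const_mul, integral_fourier_besselW hA (hB i hi)]
    ring
  by_contra hne
  push Not at hne
  have hs : (s.filter fun i => c i ≠ 0).Nonempty := by
    obtain ⟨i, hi, hi'⟩ := hne
    exact ⟨i, Finset.mem_filter.2 ⟨hi, hi'⟩⟩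
  -- the component whose Fourier transform decays most slowly
  obtain ⟨j, hj, hmin⟩ := Finset.exists_min_image _ (fun i => toLex (B i, ν i)) hs
  obtain ⟨hjs, hcj⟩ := Finset.mem_filter.1 hj
  -- the limits of the transforms, normalized by that of the component `j`
  set ℓ : ι → ℝ := fun i => if B i = B j ∧ ν i + 1 / 2 = ν j + 1 / 2
    then √(Real.pi / 2) * √(B i) ^ (ν i + 1 / 2 - 1 / 2) else 0 with hℓ
  set r : ℝ → ℝ := fun ξ => √(1 + ξ ^ 2 / A) with hr
  have hr2 : ∀ ξ, r ξ ^ 2 = 1 + ξ ^ 2 / A := fun ξ => Real.sq_sqrt (by positivity)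
  have hrtop : Tendsto r atTop atTop := by
    refine Real.tendsto_sqrt_atTop.comp (tendsto_atTop_add_const_left _ _ ?_)
    exact (tendsto_pow_atTop two_ne_zero).atTop_div_const hA
  set g : ι → ℝ → ℝ := fun i ξ => (r ξ ^ 2) ^ (-(ν i + 1 / 2))
    * besselW (ν i + 1 / 2) (B i * r ξ ^ 2)
    * (r ξ ^ (ν j + 1 / 2 + 1 / 2) * Real.exp (√(B j) * r ξ)) with hg
  have hglim : ∀ i ∈ s.filter fun i => c i ≠ 0, Tendsto (g i) atTop (𝓝 (ℓ i)) := fun i hi => by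
    refine (tendsto_normalized_besselW (ν i + 1 / 2) (ν j + 1 / 2)
      (hB i (Finset.mem_filter.1 hi).1) ?_).comp hrtop
    rcases (Prod.Lex.le_iff).1 (hmin i hi) with h1 | ⟨h1, h2⟩
    · exact Or.inl h1
    · refine Or.inr ⟨h1, ?_⟩
      have h2 : ν j ≤ ν i := h2
      linarith
  have hgsum : ∀ ξ : ℝ, ∑ i ∈ s with c i ≠ 0,
      (c i : ℂ) * Complex.exp (Complex.I * ξ * m i) * (g i ξ : ℂ) = 0 := fun ξ => by
    have h1 := hF ξ
    rw [← Finset.sum_filter_of_ne (p := fun i => c i ≠ 0)] at h1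
    · rw [← mul_zero (((r ξ ^ (ν j + 1 / 2 + 1 / 2) * Real.exp (√(B j) * r ξ) : ℝ)) : ℂ), ← h1,
        Finset.mul_sum]
      refine Finset.sum_congr rfl fun i _ => ?_
      simp only [hg, hr2]
      push_cast
      ring
    · intro i _ h2 h3
      simp [h3] at h2
  have hlim : Tendsto (fun ξ : ℝ => ∑ i ∈ s with c i ≠ 0,
      ((c i : ℂ) * (ℓ i : ℂ)) * Complex.exp (Complex.I * ξ * m i)) atTop (𝓝 0) := by
    have h1 : Tendsto (fun ξ : ℝ => ∑ i ∈ s with c i ≠ 0, (c i : ℂ)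
        * (Complex.exp (Complex.I * ξ * m i) * ((ℓ i - g i ξ : ℝ) : ℂ))) atTop (𝓝 0) := by
      suffices h0 : ∀ i ∈ s.filter fun i => c i ≠ 0, Tendsto (fun ξ : ℝ => (c i : ℂ)
          * (Complex.exp (Complex.I * ξ * m i) * ((ℓ i - g i ξ : ℝ) : ℂ))) atTop (𝓝 0) by
        simpa only [Finset.sum_const_zero] using tendsto_finsetSum _ h0
      intro i hi
      rw [← mul_zero (c i : ℂ)]
      refine Tendsto.const_mul _ (tendsto_zero_iff_norm_tendsto_zero.2 ?_)
      have h2 := ((hglim i hi).const_sub (ℓ i)).norm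
      rw [sub_self, norm_zero] at h2
      refine h2.congr fun ξ => ?_
      rw [norm_mul, Complex.norm_real, show Complex.I * ξ * m i = ((ξ * m i : ℝ) : ℂ) * Complex.I by
        push_cast; ring, Complex.norm_exp_ofReal_mul_I, one_mul]
    refine h1.congr fun ξ => ?_
    rw [← sub_zero (∑ i ∈ s with c i ≠ 0, _ * Complex.exp _), ← hgsum ξ, ← Finset.sum_sub_distrib]
    refine Finset.sum_congr rfl fun i _ => ?_
    push_cast
    ring
  have hS : Tendsto (fun ξ : ℝ => ∑ i ∈ (s.filter fun i => c i ≠ 0) with B i = B j ∧ ν i = ν j,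
      ((c i : ℂ) * (ℓ i : ℂ)) * Complex.exp (Complex.I * ξ * m i)) atTop (𝓝 0) := by
    refine hlim.congr fun ξ => (Finset.sum_filter_of_ne fun i _ h1 => ?_).symm
    by_contra h2
    apply h1
    have h3 : ℓ i = 0 := by
      simp only [hℓ]
      rw [if_neg fun h4 => h2 ⟨h4.1, by linarith [h4.2]⟩]
    rw [h3]; simp
  have hcoeff := eq_zero_of_tendsto_trigonometric_sum m _ (fun i hi k hk hik => ?_) _ hS j
    (Finset.mem_filter.2 ⟨hj, rfl, rfl⟩)
  · rcases mul_eq_zero.1 hcoeff with h1 | h1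
    · exact hcj (by exact_mod_cast h1)
    · have h2 : ℓ j = 0 := by exact_mod_cast h1
      simp only [hℓ] at h2
      rw [if_pos ⟨trivial, trivial⟩] at h2
      have := Real.sqrt_pos.2 (hB j hjs)
      have : 0 < √(Real.pi / 2) * √(B j) ^ (ν j + 1 / 2 - 1 / 2) := by positivity
      exact this.ne' h2
  · simp only [Finset.coe_filter, Finset.mem_filter, mem_ofPred_eq] at hi hk
    refine hinj hi.1.1 hk.1.1 ?_
    simp only [Prod.mk.injEq]
    exact ⟨hi.2.2.trans hk.2.2.symm, hik, hi.2.1.trans hk.2.1.symm⟩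

/-- Linear independence of the one-dimensional sections of generalized hyperbolic densities. -/
theorem eq_zero_of_sum_exp_mul_besselW_eq_zero {ι : Type*} (s : Finset ι) (c ν α γ m B : ι → ℝ)
    (hα : ∀ i ∈ s, 0 < α i) (hB : ∀ i ∈ s, 0 < B i)
    (hinj : InjOn (fun i => (ν i, α i, γ i, m i, B i)) s)
    (h : ∀ x, ∑ i ∈ s, c i * (Real.exp (γ i * x)
      * besselW (ν i) (α i ^ 2 * (x - m i) ^ 2 + B i)) = 0) : ∀ i ∈ s, c i = 0 := by
  intro j hj
  have h1 := sum_filter_besselW_eq_zero s c ν α γ m B hα hB h (α j) (γ j)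
  refine eq_zero_of_sum_besselW_eq_zero _ c ν m B (pow_pos (hα j hj) 2)
    (fun i hi => hB i (Finset.mem_filter.1 hi).1) (fun i hi k hk hik => ?_) h1 j
    (Finset.mem_filter.2 ⟨hj, rfl, rfl⟩)
  simp only [Finset.coe_filter, mem_ofPred_eq] at hi hk
  simp only [Prod.mk.injEq] at hik
  refine hinj hi.1 hk.1 ?_
  simp only [Prod.mk.injEq]
  exact ⟨hik.1, hi.2.1.trans hk.2.1.symm, hi.2.2.trans hk.2.2.symm, hik.2⟩

/-! ### Identifiability, generic lines and canonical densities -/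

/-- Linear independence of a family of functions implies identifiability of its finite
mixtures. -/
theorem finiteMixturesIdentifiable_of_linearIndependent {Θ X : Type*} (A : Set Θ) (f : Θ → X → ℝ)
    (hlin : ∀ (s : Finset Θ) (c : Θ → ℝ), (s : Set Θ) ⊆ A → (∀ x, ∑ t ∈ s, c t * f t x = 0) →
      ∀ t ∈ s, c t = 0) : FiniteMixturesIdentifiable A f := by
  classical
  intro G H w v θ η hw hv _ _ hθA hηA hθ hη hmix
  set s : Finset Θ := Finset.univ.image θ ∪ Finset.univ.image η with hs
  have hθs : ∀ g, θ g ∈ s := fun g =>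
    Finset.mem_union_left _ (Finset.mem_image_of_mem _ (Finset.mem_univ g))
  have hηs : ∀ h, η h ∈ s := fun h =>
    Finset.mem_union_right _ (Finset.mem_image_of_mem _ (Finset.mem_univ h))
  have hsA : (s : Set Θ) ⊆ A := by
    intro t ht
    rcases Finset.mem_union.1 (Finset.mem_coe.1 ht) with h | h <;>
      obtain ⟨i, -, rfl⟩ := Finset.mem_image.1 h
    · exact hθA i
    · exact hηA i
  have hzero := hlin s
    (fun t => (∑ g, if θ g = t then w g else 0) - ∑ h, if η h = t then v h else 0) hsA fun x => by
      simp_rw [sub_mul, Finset.sum_mul, Finset.sum_sub_distrib]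
      rw [Finset.sum_comm, Finset.sum_comm (s := s) (t := (Finset.univ : Finset (Fin H)))]
      simp_rw [ite_mul, zero_mul, Finset.sum_ite_eq, hθs, hηs, if_true]
      exact sub_eq_zero.2 (hmix x)
  have hfwd : ∀ g, ∃ h, η h = θ g := fun g => by
    by_contra hne
    push Not at hne
    have h1 := hzero _ (hθs g)
    simp only [hne, if_false, Finset.sum_const_zero, sub_zero, hθ.eq_iff,
      Finset.sum_ite_eq', Finset.mem_univ, if_true] at h1
    exact (hw g).ne' h1
  have hbwd : ∀ h, ∃ g, θ g = η h := fun h => by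
    by_contra hne
    push Not at hne
    have h1 := hzero _ (hηs h)
    simp only [hne, if_false, Finset.sum_const_zero, zero_sub, hη.eq_iff,
      Finset.sum_ite_eq', Finset.mem_univ, if_true, neg_eq_zero] at h1
    exact (hv h).ne' h1
  choose σ hσ using hfwd
  have hbij : Function.Bijective σ := by
    refine ⟨fun g g' hgg => hθ ?_, fun h => ?_⟩
    · rw [← hσ g, ← hσ g', hgg]
    · obtain ⟨g, hg⟩ := hbwd h
      exact ⟨g, hη (by rw [hσ, hg])⟩
  refine ⟨Equiv.ofBijective σ hbij, fun g => ⟨?_, (hσ g).symm⟩⟩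
  have h1 := hzero _ (hθs g)
  simp only [← hσ g, hη.eq_iff, Finset.sum_ite_eq', Finset.mem_univ, if_true] at h1
  simp only [hσ g, hθ.eq_iff, Finset.sum_ite_eq', Finset.mem_univ, if_true] at h1
  exact sub_eq_zero.1 h1

/-- A property of vectors is generic if it holds outside the zero set of a nonzero polynomial. -/
def Generic {p : ℕ} (Q : (Fin p → ℝ) → Prop) : Prop :=
  ∃ P : MvPolynomial (Fin p) ℝ, P ≠ 0 ∧ ∀ d, MvPolynomial.eval d P ≠ 0 → Q d

namespace Generic

variable {p : ℕ}

lemma exists_vector {Q : (Fin p → ℝ) → Prop} (h : Generic Q) : ∃ d, Q d := by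
  obtain ⟨P, hP, hQ⟩ := h
  by_contra hne
  push Not at hne
  refine hP (MvPolynomial.funext fun d => ?_)
  rw [map_zero]
  by_contra h0
  exact hne d (hQ d h0)

lemma mono {Q Q' : (Fin p → ℝ) → Prop} (h : Generic Q) (hQ : ∀ d, Q d → Q' d) : Generic Q' := by
  obtain ⟨P, hP, hPQ⟩ := h
  exact ⟨P, hP, fun d hd => hQ d (hPQ d hd)⟩

lemma forall_finset {κ : Type*} (t : Finset κ) {Q : κ → (Fin p → ℝ) → Prop}
    (h : ∀ k ∈ t, Generic (Q k)) : Generic fun d => ∀ k ∈ t, Q k d := by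
  classical
  induction t using Finset.induction_on with
  | empty => exact ⟨1, one_ne_zero, by simp⟩
  | insert k t _ ih =>
    obtain ⟨P, hP, hPQ⟩ := h k (Finset.mem_insert_self k t)
    obtain ⟨P', hP', hPQ'⟩ := ih fun i hi => h i (Finset.mem_insert_of_mem hi)
    refine ⟨P * P', mul_ne_zero hP hP', fun d hd i hi => ?_⟩
    rw [map_mul] at hd
    rcases Finset.mem_insert.1 hi with rfl | hi
    · exact hPQ d (left_ne_zero_of_mul hd)
    · exact hPQ' d (right_ne_zero_of_mul hd) i hi

lemma and {Q Q' : (Fin p → ℝ) → Prop} (h : Generic Q) (h' : Generic Q') :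
    Generic fun d => Q d ∧ Q' d := by
  refine (forall_finset Finset.univ (Q := fun b : Bool => if b then Q else Q') ?_).mono
    fun d hd => ⟨by simpa using hd true, by simpa using hd false⟩
  rintro (_ | _) _ <;> simpa

lemma imp {Q : (Fin p → ℝ) → Prop} {a : Prop} (h : a → Generic Q) : Generic fun d => a → Q d := by
  by_cases ha : a
  · exact (h ha).mono fun d hd _ => hd
  · exact ⟨1, one_ne_zero, fun d _ ha' => absurd ha' ha⟩

lemma of_eval {P : MvPolynomial (Fin p) ℝ} {f : (Fin p → ℝ) → ℝ}
    (hf : ∀ d, MvPolynomial.eval d P = f d) {d₀ : Fin p → ℝ} (h : f d₀ ≠ 0) :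
    Generic fun d => f d ≠ 0 :=
  ⟨P, fun h0 => h (by rw [← hf, h0, map_zero]), fun d hd => by rwa [hf] at hd⟩

lemma dotProduct_ne_zero {v : Fin p → ℝ} (hv : v ≠ 0) : Generic fun d => v ⬝ᵥ d ≠ 0 := by
  refine of_eval (P := ∑ i, MvPolynomial.C (v i) * MvPolynomial.X i) (d₀ := v) (fun d => ?_)
    fun h => hv (dotProduct_self_eq_zero.1 h)
  simp [dotProduct]

lemma quadratic_ne_zero {N : Matrix (Fin p) (Fin p) ℝ} (hN : N.IsSymm) (h0 : N ≠ 0) :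
    Generic fun d => d ⬝ᵥ (N *ᵥ d) ≠ 0 := by
  have hex : ∃ d₀ : Fin p → ℝ, d₀ ⬝ᵥ (N *ᵥ d₀) ≠ 0 := by
    by_contra hne
    push Not at hne
    have hsymm : ∀ u v : Fin p → ℝ, u ⬝ᵥ (N *ᵥ v) = v ⬝ᵥ (N *ᵥ u) := fun u v => by
      rw [Matrix.dotProduct_mulVec, ← Matrix.mulVec_transpose, hN.eq, dotProduct_comm]
    refine h0 (Matrix.ext fun i j => ?_)
    have h1 := hne (Pi.single i 1 + Pi.single j 1)
    rw [Matrix.mulVec_add, add_dotProduct, dotProduct_add, dotProduct_add, hne, hne,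
      hsymm (Pi.single j 1)] at h1
    have h2 : (Pi.single i 1 : Fin p → ℝ) ⬝ᵥ (N *ᵥ Pi.single j 1) = N i j := by simp
    rw [h2] at h1
    simp only [Matrix.zero_apply]
    linarith
  obtain ⟨d₀, hd₀⟩ := hex
  refine of_eval (P := ∑ i, MvPolynomial.X i * ∑ j, MvPolynomial.C (N i j) * MvPolynomial.X j)
    (fun d => ?_) hd₀
  simp [dotProduct, Matrix.mulVec]

end Generic

/-- The generalized hyperbolic density in canonical form, up to normalization: a Bessel factor of
a quadratic function times an exponential factor. -/
def ghCore {p : ℕ} (ν C : ℝ) (μ g : Fin p → ℝ) (M : Matrix (Fin p) (Fin p) ℝ) (x : Fin p → ℝ) : ℝ :=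
  Real.exp (g ⬝ᵥ x) * besselW ν ((x - μ) ⬝ᵥ (M *ᵥ (x - μ)) + C)

/-- Completing the square of a quadratic form along the line through the origin spanned by `d`. -/
lemma quadratic_along_line {p : ℕ} {M : Matrix (Fin p) (Fin p) ℝ} (hM : M.IsSymm) (μ d : Fin p → ℝ)
    {a m : ℝ} (ha : d ⬝ᵥ (M *ᵥ d) = a) (hm : d ⬝ᵥ (M *ᵥ μ) = a * m) (t : ℝ) :
    (t • d - μ) ⬝ᵥ (M *ᵥ (t • d - μ))
      = a * (t - m) ^ 2 + (m • d - μ) ⬝ᵥ (M *ᵥ (m • d - μ)) := by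
  have hm' : μ ⬝ᵥ (M *ᵥ d) = a * m := by
    rw [Matrix.dotProduct_mulVec, ← Matrix.mulVec_transpose, hM.eq, dotProduct_comm, hm]
  simp only [Matrix.mulVec_sub, Matrix.mulVec_smul, sub_dotProduct, dotProduct_sub,
    smul_dotProduct, dotProduct_smul, smul_eq_mul, ha, hm, hm']
  ring

/-- Linear independence of the canonical densities: on a generic line through the origin they
restrict to distinct one-dimensional ones. -/
theorem eq_zero_of_sum_ghCore_eq_zero {p : ℕ} (hp : 1 ≤ p) {ι : Type*} (s : Finset ι)
    (c ν C : ι → ℝ) (μ g : ι → Fin p → ℝ) (M : ι → Matrix (Fin p) (Fin p) ℝ)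
    (hC : ∀ i ∈ s, 0 < C i) (hM : ∀ i ∈ s, (M i).PosDef)
    (hinj : InjOn (fun i => (ν i, C i, μ i, g i, M i)) s)
    (h : ∀ x, ∑ i ∈ s, c i * ghCore (ν i) (C i) (μ i) (g i) (M i) x = 0) : ∀ i ∈ s, c i = 0 := by
  classical
  have hsymm : ∀ i ∈ s, (M i).IsSymm := fun i hi => by
    have := (hM i hi).isHermitian.eq
    rwa [Matrix.conjTranspose_eq_transpose_of_trivial] at this
  have hgen : Generic fun d : Fin p → ℝ => d ≠ 0 ∧ ∀ i ∈ s, ∀ j ∈ s,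
      (M i - M j ≠ 0 → d ⬝ᵥ ((M i - M j) *ᵥ d) ≠ 0) ∧ (g i - g j ≠ 0 → (g i - g j) ⬝ᵥ d ≠ 0) ∧
        (M i *ᵥ (μ i - μ j) ≠ 0 → (M i *ᵥ (μ i - μ j)) ⬝ᵥ d ≠ 0) := by
    refine Generic.and ?_ (Generic.forall_finset s fun i hi => Generic.forall_finset s fun j hj =>
      (Generic.imp fun h0 => ?_).and ((Generic.imp Generic.dotProduct_ne_zero).and
        (Generic.imp Generic.dotProduct_ne_zero)))
    · have h1 : (1 : Fin p → ℝ) ≠ 0 := fun h0 => one_ne_zero (congrFun h0 ⟨0, hp⟩)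
      exact (Generic.dotProduct_ne_zero h1).mono fun d hd h0 => hd (by rw [h0, dotProduct_zero])
    · exact Generic.quadratic_ne_zero ((hsymm i hi).sub (hsymm j hj)) h0
  obtain ⟨d, hd0, hd⟩ := hgen.exists_vector
  set a : ι → ℝ := fun i => d ⬝ᵥ (M i *ᵥ d) with ha
  set m : ι → ℝ := fun i => d ⬝ᵥ (M i *ᵥ μ i) / a i with hm
  set B : ι → ℝ := fun i => (m i • d - μ i) ⬝ᵥ (M i *ᵥ (m i • d - μ i)) + C i with hBdef
  have hapos : ∀ i ∈ s, 0 < a i := fun i hi => by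
    simpa using (hM i hi).dotProduct_mulVec_pos hd0
  refine eq_zero_of_sum_exp_mul_besselW_eq_zero s c ν (fun i => √(a i)) (fun i => g i ⬝ᵥ d) m B
    (fun i hi => Real.sqrt_pos.2 (hapos i hi)) (fun i hi => ?_) (fun i hi j hj hij => ?_)
    fun t => ?_
  · have h1 : 0 ≤ (m i • d - μ i) ⬝ᵥ (M i *ᵥ (m i • d - μ i)) := by
      simpa using (hM i hi).posSemidef.dotProduct_mulVec_nonneg (m i • d - μ i)
    exact add_pos_of_nonneg_of_pos h1 (hC i hi)
  · have hi : i ∈ s := hi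
    have hj : j ∈ s := hj
    obtain ⟨hd1, hd2, hd3⟩ := hd i hi j hj
    simp only [Prod.mk.injEq] at hij
    obtain ⟨h1, h2, h3, h4, h5⟩ := hij
    have haij : a i = a j := (Real.sqrt_inj (hapos i hi).le (hapos j hj).le).1 h2
    have hMij : M i = M j := by
      by_contra hne
      refine hd1 (sub_ne_zero.2 hne) ?_
      rw [Matrix.sub_mulVec, dotProduct_sub]
      exact sub_eq_zero.2 haij
    have hgij : g i = g j := by
      by_contra hne
      refine hd2 (sub_ne_zero.2 hne) ?_
      rw [sub_dotProduct]
      exact sub_eq_zero.2 h3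
    have hμij : μ i = μ j := by
      by_contra hne
      refine hd3 (fun h0 => ?_) ?_
      · have h6 := (hM i hi).dotProduct_mulVec_pos (sub_ne_zero.2 hne)
        rw [h0, dotProduct_zero] at h6
        exact h6.false
      · have h6 : d ⬝ᵥ (M i *ᵥ μ i) = d ⬝ᵥ (M j *ᵥ μ j) := by
          simp only [hm] at h4
          rw [haij, div_left_inj' (hapos j hj).ne'] at h4
          exact h4
        rw [dotProduct_comm, Matrix.mulVec_sub, dotProduct_sub, h6, hMij, sub_self]
    have hCij : C i = C j := by
      simp only [hBdef, h4, hMij, hμij] at h5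
      linarith
    refine hinj hi hj ?_
    simp only [Prod.mk.injEq]
    exact ⟨h1, hCij, hμij, hgij, hMij⟩
  · rw [← h (t • d)]
    refine Finset.sum_congr rfl fun i hi => ?_
    have h1 := quadratic_along_line (hsymm i hi) (μ i) d (a := a i) (m := m i) rfl
      (by rw [hm, mul_div_cancel₀ _ (hapos i hi).ne']) t
    rw [ghCore, h1, Real.sq_sqrt (hapos i hi).le, dotProduct_smul, smul_eq_mul, add_assoc,
      mul_comm t]

/-! ### The two parameterizations -/

/-- Identifiability for a family of densities that are brought into canonical form by an injective
change of parameters. -/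
theorem finiteMixturesIdentifiable_of_ghCore {p : ℕ} (hp : 1 ≤ p) {Θ : Type*} (A : Set Θ)
    (f : Θ → (Fin p → ℝ) → ℝ) (ν C : Θ → ℝ) (μ g : Θ → Fin p → ℝ)
    (M : Θ → Matrix (Fin p) (Fin p) ℝ) (hC : ∀ t ∈ A, 0 < C t) (hM : ∀ t ∈ A, (M t).PosDef)
    (hinj : InjOn (fun t => (ν t, C t, μ t, g t, M t)) A)
    (hf : ∀ t ∈ A, ∃ k ≠ 0, ∀ x, f t x = k * ghCore (ν t) (C t) (μ t) (g t) (M t) x) :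
    FiniteMixturesIdentifiable A f := by
  classical
  refine finiteMixturesIdentifiable_of_linearIndependent A f fun s c hs hsum => ?_
  choose! k hk0 hk using hf
  have h := eq_zero_of_sum_ghCore_eq_zero hp s (fun t => c t * k t) ν C μ g M
    (fun t ht => hC t (hs ht)) (fun t ht => hM t (hs ht)) (hinj.mono hs) fun x => by
      rw [← hsum x]
      refine Finset.sum_congr rfl fun t ht => ?_
      rw [hk t (hs ht), mul_assoc]
  exact fun t ht => (mul_eq_zero.1 (h t ht)).resolve_right (hk0 t (hs ht))

lemma div_rpow_mul_besselK (ν : ℝ) {a X : ℝ} (ha : 0 < a) (hX : 0 < X) :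
    (X / a) ^ (ν / 2) * besselK ν (√(a * X)) = ((a ^ 2) ^ (ν / 2))⁻¹ * besselW ν (a * X) := by
  rw [besselW, show X / a = a * X / a ^ 2 by field_simp,
    Real.div_rpow (by positivity) (by positivity)]
  ring

lemma dotProduct_inv_mulVec_nonneg {p : ℕ} {S : Matrix (Fin p) (Fin p) ℝ} (hS : S.PosDef)
    (v : Fin p → ℝ) : 0 ≤ v ⬝ᵥ (S⁻¹ *ᵥ v) := by
  simpa using hS.inv.posSemidef.dotProduct_mulVec_nonneg v

/-- The quadratic form and the additive constant of the Bessel factor, after the factor `a` has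
been absorbed into them. -/
lemma mul_add_sqMahalanobis {p : ℕ} (a ω : ℝ) (x μ : Fin p → ℝ) (S : Matrix (Fin p) (Fin p) ℝ) :
    a * (ω + sqMahalanobis x μ S) = (x - μ) ⬝ᵥ ((a • S⁻¹) *ᵥ (x - μ)) + a * ω := by
  rw [sqMahalanobis, Matrix.smul_mulVec, dotProduct_smul, smul_eq_mul]
  ring

lemma mulVec_inv_mulVec {p : ℕ} {S : Matrix (Fin p) (Fin p) ℝ} (hS : S.PosDef) (v : Fin p → ℝ) :
    S *ᵥ (S⁻¹ *ᵥ v) = v := by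
  rw [Matrix.mulVec_mulVec, Matrix.mul_nonsing_inv _ hS.det_pos.ne'.isUnit, Matrix.one_mulVec]

/-- Proportional inverses belong to proportional matrices. -/
lemma eq_smul_of_smul_inv_eq {p : ℕ} {S S' : Matrix (Fin p) (Fin p) ℝ} (hS : S.PosDef)
    (hS' : S'.PosDef) {a a' : ℝ} (ha : 0 < a) (h : a • S⁻¹ = a' • S'⁻¹) : S' = (a' / a) • S := by
  have h1 : S⁻¹ = (a' / a) • S'⁻¹ := by
    rw [div_eq_inv_mul, mul_smul, ← h, smul_smul, inv_mul_cancel₀ ha.ne', one_smul]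
  have h2 : S * (S⁻¹ * S') = S * ((a' / a) • (S'⁻¹ * S')) := by
    rw [h1, Matrix.smul_mul]
  rwa [← Matrix.mul_assoc, Matrix.mul_nonsing_inv _ hS.det_pos.ne'.isUnit,
    Matrix.nonsing_inv_mul _ hS'.det_pos.ne'.isUnit, Matrix.one_mul, Matrix.mul_smul,
    Matrix.mul_one] at h2

/-- The factor `ω + β' Σ⁻¹ β` of the argument of the Bessel function. -/
def GHParam.skewConc {p : ℕ} (θ : GHParam p) : ℝ := θ.ω + θ.β ⬝ᵥ (θ.S⁻¹ *ᵥ θ.β)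

lemma GHParam.skewConc_pos {p : ℕ} {θ : GHParam p} (hθ : θ ∈ GHParam.admissible p) :
    0 < θ.skewConc :=
  add_pos_of_pos_of_nonneg hθ.1 (dotProduct_inv_mulVec_nonneg hθ.2 _)

lemma GHParam.density_eq_ghCore {p : ℕ} {θ : GHParam p} (hθ : θ ∈ GHParam.admissible p) :
    ∃ k ≠ 0, ∀ x, θ.density x = k * ghCore (θ.lam - (p : ℝ) / 2) (θ.skewConc * θ.ω) θ.μ
      (θ.S⁻¹ *ᵥ θ.β) (θ.skewConc • θ.S⁻¹) x := by
  have ha := GHParam.skewConc_pos hθ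
  have hω : 0 < θ.ω := hθ.1
  have hdet := Real.sqrt_pos.2 hθ.2.det_pos
  have hK := besselK_pos θ.lam hω
  refine ⟨((θ.skewConc ^ 2) ^ ((θ.lam - (p : ℝ) / 2) / 2))⁻¹
    / ((2 * Real.pi) ^ ((p : ℝ) / 2) * √(θ.S.det) * besselK θ.lam θ.ω
      * Real.exp ((θ.S⁻¹ *ᵥ θ.β) ⬝ᵥ θ.μ)), by positivity, fun x => ?_⟩
  have hX : 0 < θ.ω + sqMahalanobis x θ.μ θ.S :=
    add_pos_of_pos_of_nonneg hω (dotProduct_inv_mulVec_nonneg hθ.2 _)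
  have h1 : Real.exp (-((x - θ.μ) ⬝ᵥ (θ.S⁻¹ *ᵥ θ.β)))
      = Real.exp ((θ.S⁻¹ *ᵥ θ.β) ⬝ᵥ θ.μ) / Real.exp ((θ.S⁻¹ *ᵥ θ.β) ⬝ᵥ x) := by
    rw [← Real.exp_sub, dotProduct_comm, dotProduct_sub, neg_sub]
  have h2 := div_rpow_mul_besselK (θ.lam - (p : ℝ) / 2) ha hX
  rw [GHParam.density, ghCore, ← mul_add_sqMahalanobis, h1]
  change ((θ.ω + sqMahalanobis x θ.μ θ.S) / θ.skewConc) ^ ((θ.lam - (p : ℝ) / 2) / 2)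
    * (besselK _ (√(θ.skewConc * (θ.ω + sqMahalanobis x θ.μ θ.S))) / _) = _
  rw [← mul_div_assoc, h2]
  field_simp

/-- The canonical form determines `(lam, ω, μ, Σ, β)`: it leaves open only a scaling of `Σ`, under
which `ω` and the factor `ω + β' Σ⁻¹ β` would change in opposite directions. -/
lemma GHParam.injOn_canonical (p : ℕ) :
    InjOn (fun θ : GHParam p => (θ.lam - (p : ℝ) / 2, θ.skewConc * θ.ω, θ.μ, θ.S⁻¹ *ᵥ θ.β,
      θ.skewConc • θ.S⁻¹)) (GHParam.admissible p) := by
  intro θ hθ η hη h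
  simp only [Prod.mk.injEq] at h
  obtain ⟨hlam, hω, hμ, hg, hM⟩ := h
  have ha := GHParam.skewConc_pos hθ
  have hb := GHParam.skewConc_pos hη
  have hS := eq_smul_of_smul_inv_eq hθ.2 hη.2 ha hM
  set r := η.skewConc / θ.skewConc with hr
  have hrpos : 0 < r := div_pos hb ha
  have hrab : η.skewConc = r * θ.skewConc := by rw [hr, div_mul_cancel₀ _ ha.ne']
  have hβ : η.β = r • θ.β := by
    rw [← mulVec_inv_mulVec hη.2 η.β, ← hg, hS, Matrix.smul_mulVec, mulVec_inv_mulVec hθ.2]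
  have hω' : θ.ω = r * η.ω := by
    rw [hrab] at hω
    exact mul_left_cancel₀ ha.ne' (by linarith)
  have h1 : η.skewConc = η.ω + r * (θ.β ⬝ᵥ (θ.S⁻¹ *ᵥ θ.β)) := by
    rw [GHParam.skewConc, ← hg, hβ, smul_dotProduct, smul_eq_mul]
  have h2 : θ.skewConc = θ.ω + θ.β ⬝ᵥ (θ.S⁻¹ *ᵥ θ.β) := rfl
  have hr1 : r = 1 := by
    have hω0 : 0 < η.ω := hη.1
    have h3 : η.ω = r * (r * η.ω) := by rw [← hω']; rw [h1, h2] at hrab; linarith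
    have h4 : r * r = 1 := mul_right_cancel₀ hω0.ne' (by linarith)
    nlinarith
  rw [hr1, one_smul] at hS hβ
  rw [hr1, one_mul] at hω'
  exact GHParam.ext (by linarith) hω' hμ hS.symm hβ.symm

/-- The factor `ψ + α' Δ⁻¹ α` of the argument of the Bessel function. -/
def GHUnitParam.skewConc {p : ℕ} (θ : GHUnitParam p) : ℝ := θ.ψ + θ.α ⬝ᵥ (θ.D⁻¹ *ᵥ θ.α)

lemma GHUnitParam.skewConc_pos {p : ℕ} {θ : GHUnitParam p} (hθ : θ ∈ GHUnitParam.admissible p) :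
    0 < θ.skewConc :=
  add_pos_of_pos_of_nonneg hθ.2.1 (dotProduct_inv_mulVec_nonneg hθ.2.2.1 _)

lemma GHUnitParam.density_eq_ghCore {p : ℕ} {θ : GHUnitParam p}
    (hθ : θ ∈ GHUnitParam.admissible p) :
    ∃ k ≠ 0, ∀ x, θ.density x = k * ghCore (θ.lam - (p : ℝ) / 2) (θ.skewConc * θ.χ) θ.μ
      (θ.D⁻¹ *ᵥ θ.α) (θ.skewConc • θ.D⁻¹) x := by
  have ha := GHUnitParam.skewConc_pos hθ
  obtain ⟨hχ, hψ, hD, -⟩ := id hθ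
  have hdet := Real.sqrt_pos.2 hD.det_pos
  have hK := besselK_pos θ.lam (Real.sqrt_pos.2 (mul_pos hχ hψ))
  refine ⟨((θ.skewConc ^ 2) ^ ((θ.lam - (p : ℝ) / 2) / 2))⁻¹ * (θ.ψ / θ.χ) ^ (θ.lam / 2)
    / ((2 * Real.pi) ^ ((p : ℝ) / 2) * √(θ.D.det) * besselK θ.lam (√(θ.χ * θ.ψ))
      * Real.exp ((θ.D⁻¹ *ᵥ θ.α) ⬝ᵥ θ.μ)), by positivity, fun x => ?_⟩
  have hX : 0 < θ.χ + sqMahalanobis x θ.μ θ.D :=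
    add_pos_of_pos_of_nonneg hχ (dotProduct_inv_mulVec_nonneg hD _)
  have h1 : Real.exp ((θ.μ - x) ⬝ᵥ (θ.D⁻¹ *ᵥ θ.α))
      = Real.exp ((θ.D⁻¹ *ᵥ θ.α) ⬝ᵥ θ.μ) / Real.exp ((θ.D⁻¹ *ᵥ θ.α) ⬝ᵥ x) := by
    rw [← Real.exp_sub, dotProduct_comm, dotProduct_sub]
  have h2 := div_rpow_mul_besselK (θ.lam - (p : ℝ) / 2) ha hX
  rw [GHUnitParam.density, ghCore, ← mul_add_sqMahalanobis, h1]
  change ((θ.χ + sqMahalanobis x θ.μ θ.D) / θ.skewConc) ^ ((θ.lam - (p : ℝ) / 2) / 2)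
    * (_ * besselK _ (√(θ.skewConc * (θ.χ + sqMahalanobis x θ.μ θ.D))) / _) = _
  rw [← mul_div_assoc, mul_left_comm, h2]
  field_simp

/-- The canonical form determines `(lam, χ, ψ, μ, Δ, α)`: the determinant fixes the scale
of `Δ`. -/
lemma GHUnitParam.injOn_canonical {p : ℕ} (hp : 1 ≤ p) :
    InjOn (fun θ : GHUnitParam p => (θ.lam - (p : ℝ) / 2, θ.skewConc * θ.χ, θ.μ, θ.D⁻¹ *ᵥ θ.α,
      θ.skewConc • θ.D⁻¹)) (GHUnitParam.admissible p) := by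
  intro θ hθ η hη h
  simp only [Prod.mk.injEq] at h
  obtain ⟨hlam, hχ, hμ, hg, hM⟩ := h
  have ha := GHUnitParam.skewConc_pos hθ
  have hb := GHUnitParam.skewConc_pos hη
  have hS := eq_smul_of_smul_inv_eq hθ.2.2.1 hη.2.2.1 ha hM
  have hab : η.skewConc = θ.skewConc := by
    have hdet := congrArg Matrix.det hS
    rw [Matrix.det_smul, hθ.2.2.2, hη.2.2.2, mul_one, Fintype.card_fin] at hdet
    have := (pow_eq_one_iff_of_nonneg (div_pos hb ha).le (by omega)).1 hdet.symm
    exact (div_eq_one_iff_eq ha.ne').1 this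
  rw [hab, div_self ha.ne', one_smul] at hS
  have hα : η.α = θ.α := by
    rw [← mulVec_inv_mulVec hη.2.2.1 η.α, ← hg, hS, mulVec_inv_mulVec hθ.2.2.1]
  have hχ' : θ.χ = η.χ := by
    rw [hab] at hχ
    exact mul_left_cancel₀ ha.ne' hχ
  have hψ : θ.ψ = η.ψ := by
    rw [GHUnitParam.skewConc, GHUnitParam.skewConc, hα, hS] at hab
    linarith
  exact GHUnitParam.ext (by linarith) hχ' hψ hμ hS.symm hα.symm

theorem mainTheorem3 (p : ℕ) (hp : 1 ≤ p) :
    FiniteMixturesIdentifiable (GHParam.admissible p) GHParam.density ∧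
      FiniteMixturesIdentifiable (GHUnitParam.admissible p) GHUnitParam.density := by
  constructor
  · exact finiteMixturesIdentifiable_of_ghCore hp _ _ (fun θ => θ.lam - (p : ℝ) / 2)
      (fun θ => θ.skewConc * θ.ω) (fun θ => θ.μ) (fun θ => θ.S⁻¹ *ᵥ θ.β)
      (fun θ => θ.skewConc • θ.S⁻¹) (fun θ hθ => mul_pos (GHParam.skewConc_pos hθ) hθ.1)
      (fun θ hθ => hθ.2.inv.smul (GHParam.skewConc_pos hθ)) (GHParam.injOn_canonical p)
      (fun θ hθ => GHParam.density_eq_ghCore hθ)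
  · exact finiteMixturesIdentifiable_of_ghCore hp _ _ (fun θ => θ.lam - (p : ℝ) / 2)
      (fun θ => θ.skewConc * θ.χ) (fun θ => θ.μ) (fun θ => θ.D⁻¹ *ᵥ θ.α)
      (fun θ => θ.skewConc • θ.D⁻¹) (fun θ hθ => mul_pos (GHUnitParam.skewConc_pos hθ) hθ.1)
      (fun θ hθ => hθ.2.2.1.inv.smul (GHUnitParam.skewConc_pos hθ))
      (GHUnitParam.injOn_canonical hp) (fun θ hθ => GHUnitParam.density_eq_ghCore hθ)

end
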